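/- Fix $n\ge 0$. A weak composition of length $n$ is a vector $\alpha=(\alpha_1,\dots,\alpha_n)$ of nonnegative integers, and $x^\alpha=x_1^{\alpha_1}\cdots x_n^{\alpha_n}\in\mathbb C[x_1,\dots,x_n]$. Let $\operatorname{flat}(\alpha)$ be obtained from $\alpha$ by moving all zeros to the right end (trailing zeros being dropped when it is regarded as a strong composition). Write $\beta\trianglelefteq\gamma$ if $\beta_1+\dots+\beta_i\le\gamma_1+\dots+\gamma_i$ for all $i$. For strong compositions, $\beta\succcurlyeq\alpha$ means that the parts of $\alpha$ are obtained from $\beta$ by summing successive nonempty blocks of consecutive parts. *Polynomials.* Let $\tilde s_i$ act on weak compositions by exchanging $\alpha_i$ and $\alpha_{i+1}$ if at least one of them is $0$ and by fixing $\alpha$ otherwise; extend $\tilde s_i$ linearly to polynomials through $\tilde s_i x^\alpha=x^{\tilde s_i\alpha}$. For $1\le i\le n-1$ put $$\tilde\partial_i f=\frac{f-\tilde s_i f}{x_i-x_{i+1}},\qquad \tilde\theta_i=x_{i+1}\tilde\partial_i,\qquad \tilde\pi_i=1+\tilde\theta_i .$$ For $w\in S_n$ with reduced word $w=s_{i_1}\cdots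 s_{i_k}$ put $\tilde\theta_w=\tilde\theta_{i_1}\cdots\tilde\theta_{i_k}$ and $\tilde\pi_w=\tilde\pi_{i_1}\cdots\tilde\pi_{i_k}$. Let $w_\alpha\in S_n$ be the shortest permutation with $w_\alpha(\alpha)=\operatorname{flat}(\alpha)$, where $S_n$ acts by permuting positions. The fundamental slide polynomial and the fundamental atom are $$\mathfrak F_\alpha=\tilde\pi_{w_\alpha^{-1}}x^{\operatorname{flat}(\alpha)},\qquad \tilde{\mathcal A}_\alpha=\tilde\theta_{w_\alpha^{-1}}x^{\operatorname{flat}(\alpha)} .$$ *Fundamental shift.* For a weak composition $v$ of length $n$, $\operatorname{qshift}(v)=(w_1,\dots,w_n)$ is defined as follows, where position $0$ is regarded as carrying a nonzero entry. If $v_j\ne0$, then $w_j=v_j$ if $v_{j-1}\neq 0$, and $w_j=1$ if $v_{j-1}=0$. If $v_j=0$ and $v_{j-1}\ne0$ and $v$ has a nonzero entry to the right of position $j$, then $w_j=v_m-1$ with $v_m$ the first such entry. In all other cases $w_j=0$. *Fundamental shuffle set.* Let $\alpha,\beta$ be weak compositions of length $n$, and let $A=(2n-1)^{\alpha_1}\cdots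 3^{\alpha_{n-1}}1^{\alpha_n}$ and $B=(2n)^{\beta_1}\cdots4^{\beta_{n-1}}2^{\beta_n}$ (words, exponents denoting repetition). For a word $D$ in positive integers and symbols $*$, the runs of $D$ are its maximal weakly increasing blocks of consecutive integers, together with one run of size $0$ for each $*$, listed from left to right. Let $\operatorname{Des}(D)_i$, $\operatorname{Des}_A(D)_i$, $\operatorname{Des}_B(D)_i$ be the number of all letters, of letters from $A$, and of letters from $B$, in the $i$-th run of $D$. Then $\operatorname{qSSet}(\alpha,\beta)$ is the (finite) set of words $D$ such that 1. $D$ is a shuffle of $A$, $B$ and $k$ symbols $*$ for some $k\ge 0$, and $D$ has exactly $n$ runs; 2. whenever $D$ contains a block $c*\cdots*d$ of consecutive letters with at least one $*$ and with integers $c,d$, then $c>d$; 3. $\operatorname{flat}(\operatorname{Des}_A(D))\succcurlyeq\operatorname{flat}(\alpha)$ and $\operatorname{Des}_A(D)\trianglerighteq\alpha$; 4. $\operatorname{qshift}(\beta)\trianglerighteq\operatorname{Des}_B(D)\trianglerighteq\beta$. **Theorem.** For all weak compositions $\alpha,\beta$ of length $n$, $$\mathfrak F_\alpha\cdot\tilde{\mathcal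 A}_\beta=\sum_{D\in\operatorname{qSSet}(\alpha,\beta)}\tilde{\mathcal A}_{\operatorname{Des}(D)} .$$ -/

import Mathlib

noncomputable section

namespace FundAtom

/-! Weak compositions of length `n` are functions `Fin n → ℕ`; polynomials are elements of
`ℂ[x₁, …, xₙ] = MvPolynomial (Fin n) ℂ`. The index `i : Fin (n - 1)` stands for the pair of
neighbouring positions `i, i + 1`. -/

/-! ### Weak compositions -/

/-- The nonzero entries of a weak composition, in order: its flat as a strong composition. -/
def flatList {n : ℕ} (a : Fin n → ℕ) : List ℕ := (List.ofFn a).filter (· ≠ 0)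

/-- The flat of a weak composition as a vector of the same length: all zeros are moved to the
right end. -/
def flat {n : ℕ} (a : Fin n → ℕ) : Fin n → ℕ := fun i => (flatList a).getD i 0

/-- The cumulative sums `a₁ + ⋯ + aᵢ`. -/
def csum {n : ℕ} (a : Fin n → ℕ) (i : Fin n) : ℕ := ∑ j ∈ Finset.Iic i, a j

/-- Dominance order: `DomLE b c` means `b ⊴ c`. -/
def DomLE {n : ℕ} (b c : Fin n → ℕ) : Prop := ∀ i, csum b i ≤ csum c i

/-- The strong composition `b` refines the strong composition `a`: the parts of `a` are the sums
of successive nonempty blocks of consecutive parts of `b`. -/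
def Refines (b a : List ℕ) : Prop :=
  ∃ L : List (List ℕ), (∀ l ∈ L, l ≠ []) ∧ L.flatten = b ∧ L.map List.sum = a

/-- The first nonzero entry of `v` at or after position `j`, and `0` if there is none. -/
def nextEntry {n : ℕ} (v : Fin n → ℕ) (j : ℕ) : ℕ :=
  (((List.ofFn v).drop j).filter (· ≠ 0)).headD 0

/-- Position `j` is the first position, or the entry just before it is nonzero. -/
def PrevNonzero {n : ℕ} (v : Fin n → ℕ) (j : Fin n) : Prop :=
  ∀ k : Fin n, (k : ℕ) + 1 = j → v k ≠ 0

open Classical in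
/-- The fundamental shift of a vector: every positive entry `a` directly preceded by a zero is
reduced to `1`, and the remaining `a - 1` is moved left until it sits just after the previous
nonzero entry (or in the first position if there is no such entry). -/
def qshift {n : ℕ} (v : Fin n → ℕ) : Fin n → ℕ := fun j =>
  if v j ≠ 0 then (if PrevNonzero v j then v j else 1)
  else if PrevNonzero v j then nextEntry v j - 1
  else 0

/-! ### Permutations, reduced words -/

/-- The left position of the pair `i, i + 1`. -/
def lo {n : ℕ} (i : Fin (n - 1)) : Fin n := ⟨i, by omega⟩

/-- The right position of the pair `i, i + 1`. -/
def hi {n : ℕ} (i : Fin (n - 1)) : Fin n := ⟨i + 1, by omega⟩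

/-- The simple transposition `sᵢ`. -/
def simpleRefl {n : ℕ} (i : Fin (n - 1)) : Equiv.Perm (Fin n) := Equiv.swap (lo i) (hi i)

/-- The product `s_{i₁} ⋯ s_{iₖ}` of a word. -/
def wordPerm {n : ℕ} (l : List (Fin (n - 1))) : Equiv.Perm (Fin n) := (l.map simpleRefl).prod

/-- `l` is a reduced word of `w`: a word for `w` of least possible length. -/
def IsReducedWord {n : ℕ} (w : Equiv.Perm (Fin n)) (l : List (Fin (n - 1))) : Prop :=
  wordPerm l = w ∧ ∀ l', wordPerm l' = w → l.length ≤ l'.length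

theorem exists_word {n : ℕ} (w : Equiv.Perm (Fin n)) :
    ∃ l : List (Fin (n - 1)), wordPerm l = w := by
  cases n with
  | zero => exact ⟨[], Subsingleton.elim _ _⟩
  | succ m =>
    have h : w ∈ Submonoid.closure
        (Set.range fun i : Fin m => Equiv.swap i.castSucc i.succ) := by
      rw [Equiv.Perm.mclosure_swap_castSucc_succ]; trivial
    induction h using Submonoid.closure_induction with
    | mem x hx =>
      obtain ⟨i, rfl⟩ := hx
      refine ⟨[i], ?_⟩
      simp only [wordPerm, List.map_cons, List.map_nil, List.prod_cons, List.prod_nil, mul_one]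
      rfl
    | one => exact ⟨[], rfl⟩
    | mul x y _ _ hx hy =>
      obtain ⟨l, hl⟩ := hx
      obtain ⟨l', hl'⟩ := hy
      exact ⟨l ++ l', by rw [← hl, ← hl']; simp [wordPerm]⟩

theorem exists_reducedWord {n : ℕ} (w : Equiv.Perm (Fin n)) : ∃ l, IsReducedWord w l := by
  obtain ⟨l, hl, hmin⟩ := exists_minimalFor_of_wellFoundedLT
    (fun l : List (Fin (n - 1)) => wordPerm l = w) List.length (exists_word w)
  refine ⟨l, hl, fun l' hl' => ?_⟩
  rcases le_total l.length l'.length with h | h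
  · exact h
  · exact hmin hl' h

/-- A reduced word of `w`. -/
def reducedWord {n : ℕ} (w : Equiv.Perm (Fin n)) : List (Fin (n - 1)) :=
  (exists_reducedWord w).choose

/-- The length of a permutation. -/
def permLength {n : ℕ} (w : Equiv.Perm (Fin n)) : ℕ := (reducedWord w).length

/-- `w` is a permutation of least length with `w(a) = flat(a)`, where `w` permutes positions:
the entry of `w(a)` in position `j` is the entry of `a` in position `w⁻¹ j`. -/
def IsFlatPerm {n : ℕ} (a : Fin n → ℕ) (w : Equiv.Perm (Fin n)) : Prop :=
  a ∘ ⇑w⁻¹ = flat a ∧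
    ∀ w' : Equiv.Perm (Fin n), a ∘ ⇑w'⁻¹ = flat a → permLength w ≤ permLength w'

theorem ofFn_flat {n : ℕ} (a : Fin n → ℕ) :
    List.ofFn (flat a) = flatList a ++ List.replicate (n - (flatList a).length) 0 := by
  have hle : (flatList a).length ≤ n := by
    have h := List.length_filter_le (fun x : ℕ => decide (x ≠ 0)) (List.ofFn a)
    rwa [List.length_ofFn] at h
  apply List.ext_getElem
  · simp; omega
  · intro i h1 h2
    rw [List.getElem_append]
    split_ifs with h
    · simp [flat, h]
    · simp [flat, not_lt.mp h]

theorem ofFn_flat_perm {n : ℕ} (a : Fin n → ℕ) :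
    (List.ofFn (flat a)).Perm (List.ofFn a) := by
  rw [ofFn_flat]
  have h := List.filter_append_perm (fun x : ℕ => decide (x ≠ 0)) (List.ofFn a)
  refine List.Perm.trans (List.Perm.append_left _ (List.Perm.of_eq ?_)) h
  have hl := h.length_eq
  rw [List.length_append, List.length_ofFn] at hl
  symm
  rw [List.eq_replicate_iff]
  refine ⟨?_, ?_⟩
  · change (List.filter _ _).length = n - (List.filter _ _).length
    omega
  · intro x hx
    have := (List.mem_filter.mp hx).2
    simpa using this

theorem exists_flatPerm {n : ℕ} (a : Fin n → ℕ) : ∃ w, IsFlatPerm a w := by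
  have hex : ∃ w : Equiv.Perm (Fin n), a ∘ ⇑w⁻¹ = flat a := by
    have hp : (List.ofFn (a ∘ Tuple.sort a)).Perm (List.ofFn (flat a ∘ Tuple.sort (flat a))) :=
      ((Equiv.Perm.ofFn_comp_perm _ _).trans (ofFn_flat_perm a).symm).trans
        (Equiv.Perm.ofFn_comp_perm _ _).symm
    have h1 := (Tuple.monotone_sort a).sortedLE_ofFn
    have h2 := (Tuple.monotone_sort (flat a)).sortedLE_ofFn
    have h3 := List.ofFn_injective (hp.eq_of_sortedLE h1 h2)
    refine ⟨(Tuple.sort a * (Tuple.sort (flat a))⁻¹)⁻¹, ?_⟩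
    funext i
    have := congrFun h3 ((Tuple.sort (flat a))⁻¹ i)
    simpa using this
  obtain ⟨w, hw, hmin⟩ := exists_minimalFor_of_wellFoundedLT
    (fun w : Equiv.Perm (Fin n) => a ∘ ⇑w⁻¹ = flat a) permLength hex
  refine ⟨w, hw, fun w' hw' => ?_⟩
  rcases le_total (permLength w) (permLength w') with h | h
  · exact h
  · exact hmin hw' h

/-- The shortest permutation `w_a` with `w_a(a) = flat(a)`. -/
def flatPerm {n : ℕ} (a : Fin n → ℕ) : Equiv.Perm (Fin n) := (exists_flatPerm a).choose

/-! ### Quasisymmetric divided differences -/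

/-- The monomial `x^a`. -/
def xpow {n : ℕ} (a : Fin n → ℕ) : MvPolynomial (Fin n) ℂ := ∏ i, MvPolynomial.X i ^ a i

/-- The quasisymmetric action of `sᵢ` on weak compositions: exchange the entries in positions
`i, i + 1` if one of them is zero, and do nothing otherwise. -/
def quasiSwap {n : ℕ} (i : Fin (n - 1)) (a : Fin n → ℕ) : Fin n → ℕ :=
  if a (lo i) = 0 ∨ a (hi i) = 0 then a ∘ simpleRefl i else a

/-- The quasisymmetric action of `sᵢ` on polynomials, extended linearly from monomials. -/
def quasiRefl {n : ℕ} (i : Fin (n - 1)) : MvPolynomial (Fin n) ℂ →ₗ[ℂ] MvPolynomial (Fin n) ℂ :=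
  (MvPolynomial.basisMonomials (Fin n) ℂ).constr ℂ fun a => xpow (quasiSwap i a)

theorem quasiRefl_monomial {n : ℕ} (i : Fin (n - 1)) (u : Fin n →₀ ℕ) (c : ℂ) :
    quasiRefl i (MvPolynomial.monomial u c) = c • xpow (quasiSwap i u) := by
  have h : (MvPolynomial.monomial u c : MvPolynomial (Fin n) ℂ)
      = c • MvPolynomial.basisMonomials (Fin n) ℂ u := by
    simp [MvPolynomial.smul_monomial]
  rw [h, map_smul, quasiRefl, Module.Basis.constr_basis]

theorem dvd_xpow_sub {n : ℕ} (i : Fin (n - 1)) (u : Fin n → ℕ) :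
    (MvPolynomial.X (lo i) - MvPolynomial.X (hi i) : MvPolynomial (Fin n) ℂ) ∣
      xpow u - xpow (quasiSwap i u) := by
  unfold quasiSwap
  split_ifs
  · rw [← Ideal.mem_span_singleton, ← Ideal.Quotient.eq]
    set q := Ideal.Quotient.mk (Ideal.span
      {(MvPolynomial.X (lo i) - MvPolynomial.X (hi i) : MvPolynomial (Fin n) ℂ)}) with hq
    have hX : q (MvPolynomial.X (lo i)) = q (MvPolynomial.X (hi i)) := by
      rw [hq, Ideal.Quotient.eq, Ideal.mem_span_singleton]
    have hs : ∀ j, q (MvPolynomial.X (simpleRefl i j)) = q (MvPolynomial.X j) := by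
      intro j
      unfold simpleRefl
      rw [Equiv.swap_apply_def]
      split_ifs with h1 h2
      · rw [h1, hX]
      · rw [h2, hX]
      · rfl
    unfold xpow
    rw [map_prod, map_prod, ← Equiv.prod_comp (simpleRefl i)]
    refine Finset.prod_congr rfl fun j _ => ?_
    simp only [map_pow, Function.comp_apply, hs]
  · simp

theorem exists_divDiff {n : ℕ} (i : Fin (n - 1)) (f : MvPolynomial (Fin n) ℂ) :
    ∃ g, f - quasiRefl i f = (MvPolynomial.X (lo i) - MvPolynomial.X (hi i)) * g := by
  change (MvPolynomial.X (lo i) - MvPolynomial.X (hi i) : MvPolynomial (Fin n) ℂ) ∣ _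
  induction f using MvPolynomial.induction_on' with
  | monomial u c =>
    have h : (MvPolynomial.monomial u c : MvPolynomial (Fin n) ℂ) = c • xpow u := by
      rw [MvPolynomial.monomial_eq, MvPolynomial.smul_eq_C_mul, xpow,
        Finsupp.prod_fintype _ _ (fun _ => pow_zero _)]
    rw [quasiRefl_monomial, h, ← smul_sub, MvPolynomial.smul_eq_C_mul]
    exact dvd_mul_of_dvd_right (dvd_xpow_sub i u) _
  | add p q hp hq =>
    rw [map_add, add_sub_add_comm]
    exact dvd_add hp hq

/-- The quasisymmetric divided difference `(f - s̃ᵢ f) / (xᵢ - xᵢ₊₁)`. -/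
def divDiff {n : ℕ} (i : Fin (n - 1)) (f : MvPolynomial (Fin n) ℂ) : MvPolynomial (Fin n) ℂ :=
  (exists_divDiff i f).choose

theorem divDiff_spec {n : ℕ} (i : Fin (n - 1)) (f : MvPolynomial (Fin n) ℂ) :
    f - quasiRefl i f = (MvPolynomial.X (lo i) - MvPolynomial.X (hi i)) * divDiff i f :=
  (exists_divDiff i f).choose_spec

/-- The operator `θ̃ᵢ = xᵢ₊₁ ∂̃ᵢ`. -/
def thetaOp {n : ℕ} (i : Fin (n - 1)) (f : MvPolynomial (Fin n) ℂ) : MvPolynomial (Fin n) ℂ :=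
  MvPolynomial.X (hi i) * divDiff i f

/-- The operator `π̃ᵢ = 1 + θ̃ᵢ`, that is, `f ↦ (xᵢ f - xᵢ₊₁ s̃ᵢ f) / (xᵢ - xᵢ₊₁)`. -/
def piOp {n : ℕ} (i : Fin (n - 1)) (f : MvPolynomial (Fin n) ℂ) : MvPolynomial (Fin n) ℂ :=
  f + thetaOp i f

/-- `θ̃_w = θ̃_{i₁} ⋯ θ̃_{iₖ}` for a reduced word `s_{i₁} ⋯ s_{iₖ}` of `w`. -/
def thetaPerm {n : ℕ} (w : Equiv.Perm (Fin n)) (f : MvPolynomial (Fin n) ℂ) :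
    MvPolynomial (Fin n) ℂ :=
  (reducedWord w).foldr thetaOp f

/-- `π̃_w = π̃_{i₁} ⋯ π̃_{iₖ}` for a reduced word `s_{i₁} ⋯ s_{iₖ}` of `w`. -/
def piPerm {n : ℕ} (w : Equiv.Perm (Fin n)) (f : MvPolynomial (Fin n) ℂ) :
    MvPolynomial (Fin n) ℂ :=
  (reducedWord w).foldr piOp f

/-- The fundamental slide polynomial of `a`. -/
def fundamentalSlide {n : ℕ} (a : Fin n → ℕ) : MvPolynomial (Fin n) ℂ :=
  piPerm (flatPerm a)⁻¹ (xpow (flat a))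

/-- The fundamental (Demazure) atom of `a`. -/
def fundamentalAtom {n : ℕ} (a : Fin n → ℕ) : MvPolynomial (Fin n) ℂ :=
  thetaPerm (flatPerm a)⁻¹ (xpow (flat a))

/-! ### Shuffles and the fundamental shuffle set -/

/-- `Shuffle u v w`: the word `w` is a shuffle of the words `u` and `v`. -/
inductive Shuffle {T : Type} : List T → List T → List T → Prop
  | nil : Shuffle [] [] []
  | left (x : T) {u v w : List T} : Shuffle u v w → Shuffle (x :: u) v (x :: w)
  | right (x : T) {u v w : List T} : Shuffle u v w → Shuffle u (x :: v) (x :: w)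

theorem Shuffle.perm {T : Type} {u v w : List T} (h : Shuffle u v w) : w.Perm (u ++ v) := by
  induction h with
  | nil => exact List.Perm.nil
  | left x _ ih => exact ih.cons x
  | right x _ ih => exact (ih.cons x).trans List.perm_middle.symm

/-- The word `A = (2n-1)^{a₁} ⋯ 3^{aₙ₋₁} 1^{aₙ}`. -/
def wordA {n : ℕ} (a : Fin n → ℕ) : List ℕ :=
  (List.finRange n).flatMap fun i => List.replicate (a i) (2 * (n - i) - 1)

/-- The word `B = (2n)^{b₁} ⋯ 4^{bₙ₋₁} 2^{bₙ}`. -/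
def wordB {n : ℕ} (b : Fin n → ℕ) : List ℕ :=
  (List.finRange n).flatMap fun i => List.replicate (b i) (2 * (n - i))

/-- The runs of a word in the letters `some c` (a number) and `none` (the symbol `∗`): the maximal
weakly increasing blocks of consecutive numbers, each `∗` counting as one empty run. -/
def runs : List (Option ℕ) → List (List ℕ)
  | [] => []
  | none :: D => [] :: runs D
  | [some c] => [[c]]
  | some c :: none :: D => [c] :: runs (none :: D)
  | some c :: some d :: D =>
    if c ≤ d then (runs (some d :: D)).modifyHead (c :: ·) else [c] :: runs (some d :: D)

/-- `Des(D)`: the vector of lengths of the runs of `D`. -/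
def des (n : ℕ) (D : List (Option ℕ)) : Fin n → ℕ := fun i => ((runs D).getD i []).length

/-- `Des_A(D)`: the numbers of letters from `A` (the odd letters) in the runs of `D`. -/
def desA (n : ℕ) (D : List (Option ℕ)) : Fin n → ℕ := fun i =>
  ((runs D).getD i []).countP (fun c => c % 2 = 1)

/-- `Des_B(D)`: the numbers of letters from `B` (the even letters) in the runs of `D`. -/
def desB (n : ℕ) (D : List (Option ℕ)) : Fin n → ℕ := fun i =>
  ((runs D).getD i []).countP (fun c => c % 2 = 0)

/-- Whenever `c ∗ ⋯ ∗ d` (with at least one `∗`) is a block of `D` with numbers `c, d`,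
then `c > d`. -/
def StarsAtDescents (D : List (Option ℕ)) : Prop :=
  ∀ (u v : List (Option ℕ)) (c d m : ℕ),
    D = u ++ some c :: List.replicate (m + 1) none ++ some d :: v → d < c

/-- Membership in the fundamental shuffle set of `a` and `b`. -/
structure InQSSet {n : ℕ} (a b : Fin n → ℕ) (D : List (Option ℕ)) : Prop where
  shuffle : ∃ (k : ℕ) (C : List ℕ), Shuffle (wordA a) (wordB b) C ∧
    Shuffle (C.map some) (List.replicate k none) D
  runs_length : (runs D).length = n
  stars : StarsAtDescents D
  refines : Refines (flatList (desA n D)) (flatList a)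
  domA : DomLE a (desA n D)
  domB : DomLE b (desB n D)
  domB_shift : DomLE (desB n D) (qshift b)

theorem count_none_le_runs (D : List (Option ℕ)) : D.count none ≤ (runs D).length := by
  induction D using runs.induct with
  | case6 c d D h ih =>
    rw [List.count_cons_of_ne (by simp)]
    simpa [runs, h] using Nat.le_succ_of_le ih
  | case4 c D ih =>
    rw [List.count_cons_of_ne (by simp)]
    simpa [runs] using Nat.le_succ_of_le ih
  | _ => simp_all [runs]

theorem finite_qSSet {n : ℕ} (a b : Fin n → ℕ) : {D | InQSSet a b D}.Finite := by
  refine (Set.finite_iUnion (ι := Fin (n + 1)) fun k => List.finite_toSet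
    ((wordA a ++ wordB b).map some ++ List.replicate (k : ℕ) none).permutations).subset ?_
  intro D hD
  obtain ⟨k, C, h1, h2⟩ := hD.shuffle
  have hp := h2.perm.trans ((h1.perm.map some).append_right _)
  have hk : k ≤ n := by
    rw [← hD.runs_length]
    refine le_trans ?_ (count_none_le_runs D)
    rw [hp.count_eq, List.count_append, List.count_replicate_self]
    exact Nat.le_add_left _ _
  refine Set.mem_iUnion.mpr ⟨⟨k, by omega⟩, ?_⟩
  exact List.mem_permutations.mpr hp

/-- The fundamental shuffle set of `a` and `b`. -/
def qSSet {n : ℕ} (a b : Fin n → ℕ) : Finset (List (Option ℕ)) := (finite_qSSet a b).toFinset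

theorem mem_qSSet {n : ℕ} {a b : Fin n → ℕ} {D : List (Option ℕ)} :
    D ∈ qSSet a b ↔ InQSSet a b D := by
  simp [qSSet]

end FundAtom

end

noncomputable section

namespace FundAtom

open MvPolynomial

/-! Both factors are multiplicity-free sums of monomials, described by prefix sums. An exponent `g`
belongs to the atom of `a` if it dominates `a`, has the same size, and at every nonzero entry of `a`
has the same prefix sum and a nonzero entry (`AtomP`). It belongs to the slide polynomial if it
dominates `a`, has the same size, and every prefix sum of `a` is a prefix sum of `g` (`SlideP`).
Both follow by running the operators along a word that flattens `a` by exchanging zeros with nonzero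
right neighbours (`thetaOp_atom`, `piOp_slide`). The potential `posSum` shows that a shortest
flattening word has this form, so braid relations are never needed. Conditions 3 and 4 of the
shuffle set restate these descriptions (`slideP_iff`, `atomP_iff`).

An exponent is also a weakly increasing word of positions. Give the letters of A the positions of a
slide monomial, those of B the positions of an atom monomial, and sort all pairs (position, letter)
lexicographically. Since A and B are weakly decreasing words, sortedness encodes the strictness
conditions. What remains is that no letter stands to the right of its own index and that each letter
value of B occurs at its index (`IsConf`). The product is the sum of the monomials of these
configurations (`slide_mul_atom_eq`).

Now move every letter to the position of the last letter of its run (`settle`). The result is again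
a configuration, since the last, largest letter of a run has the tightest bound. The configurations
settling to a given one are exactly the monomials of one atom (`fundamentalAtom_settled`). Finally,
settled configurations are the words of the shuffle set: the position of a letter is the index of
its run, and stars fill the skipped indices (`inQSSet_iff`, `label_unlabel`, `unlabel_label`). -/

/-! ### Prefix sums -/

/-- The sum of the entries in the first `k` positions. -/
def psum {n : ℕ} (a : Fin n → ℕ) (k : ℕ) : ℕ := ∑ j : Fin n, if (j : ℕ) < k then a j else 0

theorem csum_eq_psum {n : ℕ} (a : Fin n → ℕ) (i : Fin n) : csum a i = psum a ((i : ℕ) + 1) := by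
  have h : Finset.Iic i = Finset.univ.filter fun j : Fin n => (j : ℕ) < (i : ℕ) + 1 := by
    ext j
    rw [Finset.mem_Iic, Finset.mem_filter, Fin.le_def, Nat.lt_succ_iff]
    exact ⟨fun h => ⟨Finset.mem_univ _, h⟩, fun h => h.2⟩
  rw [csum, psum, h, Finset.sum_filter]

theorem psum_zero {n : ℕ} (a : Fin n → ℕ) : psum a 0 = 0 := by simp [psum]

theorem psum_succ {n : ℕ} (a : Fin n → ℕ) (i : Fin n) :
    psum a ((i : ℕ) + 1) = psum a i + a i := by
  unfold psum
  have : ∀ j : Fin n, (if (j : ℕ) < i + 1 then a j else 0)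
      = (if (j : ℕ) < i then a j else 0) + if j = i then a j else 0 := by
    intro j
    by_cases h : j = i
    · subst h; simp
    · have h' : (j : ℕ) ≠ i := fun h' => h (Fin.ext h')
      simp only [h, if_false, add_zero]
      congr 1
      exact propext ⟨fun _ => by omega, fun _ => by omega⟩
  rw [Finset.sum_congr rfl fun j _ => this j, Finset.sum_add_distrib]
  simp

theorem psum_mono {n : ℕ} (a : Fin n → ℕ) : Monotone (psum a) := by
  intro k m h
  refine Finset.sum_le_sum fun j _ => ?_
  split_ifs <;> omega

theorem psum_of_le {n : ℕ} (a : Fin n → ℕ) {k : ℕ} (h : n ≤ k) : psum a k = psum a n := by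
  unfold psum
  refine Finset.sum_congr rfl fun j _ => ?_
  rw [if_pos (by omega), if_pos j.2]

theorem psum_self {n : ℕ} (a : Fin n → ℕ) : psum a n = ∑ j, a j := by
  simp [psum]

/-- Prefix sums are constant beyond `n`, so cuts may range over all of `ℕ`. -/
theorem domLE_iff {n : ℕ} (b c : Fin n → ℕ) : DomLE b c ↔ ∀ k, psum b k ≤ psum c k := by
  simp only [DomLE, csum_eq_psum]
  refine ⟨fun h k => ?_, fun h i => h _⟩
  rcases k with _ | k
  · simp [psum_zero]
  by_cases hk : k < n
  · exact h ⟨k, hk⟩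
  · rcases n with _ | n
    · simp [psum]
    · rw [psum_of_le b (by omega), psum_of_le c (by omega)]
      exact h ⟨n, by omega⟩

theorem ext_of_psum {n : ℕ} {a b : Fin n → ℕ} (h : ∀ k, psum a k = psum b k) : a = b := by
  funext i
  have h1 := psum_succ a i
  have h2 := psum_succ b i
  rw [h, h] at h1
  omega

/-! ### Adjacent positions -/

theorem lo_val {n : ℕ} (i : Fin (n - 1)) : (lo i : ℕ) = i := rfl

theorem hi_val {n : ℕ} (i : Fin (n - 1)) : (hi i : ℕ) = i + 1 := rfl

theorem lo_ne_hi {n : ℕ} (i : Fin (n - 1)) : lo i ≠ hi i := by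
  intro h
  have := congrArg Fin.val h
  simp [lo_val, hi_val] at this

theorem psum_lo {n : ℕ} (a : Fin n → ℕ) (i : Fin (n - 1)) :
    psum a ((i : ℕ) + 1) = psum a i + a (lo i) := psum_succ a (lo i)

theorem psum_hi {n : ℕ} (a : Fin n → ℕ) (i : Fin (n - 1)) :
    psum a ((i : ℕ) + 2) = psum a ((i : ℕ) + 1) + a (hi i) := psum_succ a (hi i)

theorem psum_succ_congr {n : ℕ} {a b : Fin n → ℕ} {m : ℕ} (h : psum a m = psum b m)
    (hm : ∀ j : Fin n, (j : ℕ) = m → a j = b j) : psum a (m + 1) = psum b (m + 1) := by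
  by_cases hmn : m < n
  · have e1 := psum_succ a ⟨m, hmn⟩
    have e2 := psum_succ b ⟨m, hmn⟩
    have e3 := hm ⟨m, hmn⟩ rfl
    simp only at e1 e2
    omega
  · rw [psum_of_le a (show n ≤ m + 1 by omega), psum_of_le b (show n ≤ m + 1 by omega)]
    rwa [psum_of_le a (show n ≤ m by omega), psum_of_le b (show n ≤ m by omega)] at h

/-- Two vectors that differ only by the distribution of the entries in two neighbouring
positions have the same prefix sums, except between these positions. -/
theorem psum_congr {n : ℕ} {a b : Fin n → ℕ} (i : Fin (n - 1))
    (h : ∀ j, j ≠ lo i → j ≠ hi i → a j = b j)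
    (hs : a (lo i) + a (hi i) = b (lo i) + b (hi i)) {k : ℕ} (hk : k ≠ (i : ℕ) + 1) :
    psum a k = psum b k := by
  have h' : ∀ m, m ≠ (i : ℕ) → m ≠ (i : ℕ) + 1 → ∀ j : Fin n, (j : ℕ) = m → a j = b j := by
    intro m h1 h2 j hj
    refine h j (fun e => h1 ?_) (fun e => h2 ?_) <;> rw [← hj, e]
    exacts [lo_val i, hi_val i]
  have h1 : ∀ m, m ≤ (i : ℕ) → psum a m = psum b m := by
    intro m
    induction m with
    | zero => simp [psum_zero]
    | succ m ih => exact fun hm => psum_succ_congr (ih (by omega)) (h' m (by omega) (by omega))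
  have h2 : ∀ m, (i : ℕ) + 2 ≤ m → psum a m = psum b m := by
    intro m hm
    induction m, hm using Nat.le_induction with
    | base =>
      have e1 := psum_lo a i
      have e2 := psum_lo b i
      have e3 := psum_hi a i
      have e4 := psum_hi b i
      have e5 := h1 i le_rfl
      omega
    | succ m hm ih => exact psum_succ_congr ih (h' m (by omega) (by omega))
  rcases Nat.lt_or_ge k ((i : ℕ) + 1) with h3 | h3
  · exact h1 k (by omega)
  · exact h2 k (by omega)

/-! ### The operators on monomials -/

/-- Overwrite the entries in two neighbouring positions. -/
def setPair {n : ℕ} (i : Fin (n - 1)) (a : Fin n → ℕ) (p q : ℕ) : Fin n → ℕ :=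
  Function.update (Function.update a (lo i) p) (hi i) q

@[simp] theorem setPair_lo {n : ℕ} (i : Fin (n - 1)) (a : Fin n → ℕ) (p q : ℕ) :
    setPair i a p q (lo i) = p := by
  rw [setPair, Function.update_of_ne (lo_ne_hi i), Function.update_self]

@[simp] theorem setPair_hi {n : ℕ} (i : Fin (n - 1)) (a : Fin n → ℕ) (p q : ℕ) :
    setPair i a p q (hi i) = q := by
  rw [setPair, Function.update_self]

theorem setPair_of_ne {n : ℕ} (i : Fin (n - 1)) (a : Fin n → ℕ) (p q : ℕ) {j : Fin n}
    (h1 : j ≠ lo i) (h2 : j ≠ hi i) : setPair i a p q j = a j := by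
  rw [setPair, Function.update_of_ne h2, Function.update_of_ne h1]

theorem ext_pair {n : ℕ} (i : Fin (n - 1)) {a b : Fin n → ℕ} (h1 : a (lo i) = b (lo i))
    (h2 : a (hi i) = b (hi i)) (h : ∀ j, j ≠ lo i → j ≠ hi i → a j = b j) : a = b := by
  funext j
  by_cases e1 : j = lo i
  · rw [e1, h1]
  by_cases e2 : j = hi i
  · rw [e2, h2]
  exact h j e1 e2

@[simp] theorem setPair_setPair {n : ℕ} (i : Fin (n - 1)) (a : Fin n → ℕ) (p q p' q' : ℕ) :
    setPair i (setPair i a p q) p' q' = setPair i a p' q' :=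
  ext_pair i (by simp) (by simp) fun j h1 h2 => by simp [setPair_of_ne, h1, h2]

theorem setPair_eq_self {n : ℕ} (i : Fin (n - 1)) (a : Fin n → ℕ) {p q : ℕ} (hp : p = a (lo i))
    (hq : q = a (hi i)) : setPair i a p q = a :=
  ext_pair i (by simp [hp]) (by simp [hq]) fun j h1 h2 => by simp [setPair_of_ne, h1, h2]

theorem comp_simpleRefl {n : ℕ} (i : Fin (n - 1)) (a : Fin n → ℕ) :
    a ∘ simpleRefl i = setPair i a (a (hi i)) (a (lo i)) :=
  ext_pair i (by simp [simpleRefl]) (by simp [simpleRefl]) fun j h1 h2 => by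
    simp [simpleRefl, setPair_of_ne, h1, h2, Equiv.swap_apply_of_ne_of_ne]

theorem xpow_setPair {n : ℕ} (i : Fin (n - 1)) (a : Fin n → ℕ) (p q : ℕ) :
    xpow (setPair i a p q) = X (lo i) ^ p * X (hi i) ^ q *
      ∏ j ∈ (Finset.univ.erase (lo i)).erase (hi i), X j ^ a j := by
  rw [xpow, ← Finset.mul_prod_erase _ _ (Finset.mem_univ (lo i)),
    ← Finset.mul_prod_erase _ _ (Finset.mem_erase.mpr ⟨(lo_ne_hi i).symm, Finset.mem_univ _⟩),
    setPair_lo, setPair_hi, mul_assoc]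
  congr 2
  refine Finset.prod_congr rfl fun j hj => ?_
  simp only [Finset.mem_erase] at hj
  rw [setPair_of_ne i a p q hj.2.1 hj.1]

theorem xpow_eq_monomial {n : ℕ} (a : Fin n → ℕ) :
    xpow a = monomial (Finsupp.equivFunOnFinite.symm a) (1 : ℂ) := by
  rw [monomial_eq, xpow, Finsupp.prod_fintype _ _ (fun _ => pow_zero _)]
  simp

theorem xpow_add {n : ℕ} (a b : Fin n → ℕ) : xpow (a + b) = xpow a * xpow b := by
  simp [xpow, pow_add, Finset.prod_mul_distrib]

theorem quasiRefl_xpow {n : ℕ} (i : Fin (n - 1)) (a : Fin n → ℕ) :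
    quasiRefl i (xpow a) = xpow (quasiSwap i a) := by
  rw [xpow_eq_monomial, quasiRefl_monomial, one_smul]
  rfl

theorem X_lo_sub_X_hi_ne_zero {n : ℕ} (i : Fin (n - 1)) :
    (X (lo i) - X (hi i) : MvPolynomial (Fin n) ℂ) ≠ 0 := by
  rw [sub_ne_zero]
  exact fun h => lo_ne_hi i (X_injective h)

/-- `divDiff` is only a chosen quotient; in a domain its defining equation determines it. The
evaluations of `thetaOp` below rest on this cancellation. -/
theorem thetaOp_eq_of_mul_eq {n : ℕ} {i : Fin (n - 1)} {f g : MvPolynomial (Fin n) ℂ}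
    (h : (X (lo i) - X (hi i)) * g = X (hi i) * (f - quasiRefl i f)) : thetaOp i f = g := by
  apply mul_left_cancel₀ (X_lo_sub_X_hi_ne_zero i)
  rw [h, divDiff_spec, thetaOp]
  ring

/-- The operator `θ̃ᵢ` as an additive map. -/
def thetaHom {n : ℕ} (i : Fin (n - 1)) : MvPolynomial (Fin n) ℂ →+ MvPolynomial (Fin n) ℂ :=
  AddMonoidHom.mk' (thetaOp i) fun f g => thetaOp_eq_of_mul_eq (by
    have h1 := divDiff_spec i f
    have h2 := divDiff_spec i g
    rw [map_add, add_sub_add_comm, h1, h2, thetaOp, thetaOp]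
    ring)

theorem thetaOp_sum {n : ℕ} {ι : Type*} (i : Fin (n - 1)) (s : Finset ι)
    (f : ι → MvPolynomial (Fin n) ℂ) : thetaOp i (∑ j ∈ s, f j) = ∑ j ∈ s, thetaOp i (f j) :=
  map_sum (thetaHom i) f s

theorem thetaOp_xpow_of_ne_zero {n : ℕ} {i : Fin (n - 1)} {a : Fin n → ℕ} (h1 : a (lo i) ≠ 0)
    (h2 : a (hi i) ≠ 0) : thetaOp i (xpow a) = 0 :=
  thetaOp_eq_of_mul_eq (by simp [quasiRefl_xpow, quasiSwap, h1, h2])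

theorem thetaOp_xpow_of_hi_eq_zero {n : ℕ} {i : Fin (n - 1)} {a : Fin n → ℕ}
    (h : a (hi i) = 0) :
    thetaOp i (xpow a) = ∑ p ∈ Finset.range (a (lo i)), xpow (setPair i a p (a (lo i) - p)) := by
  apply thetaOp_eq_of_mul_eq
  have e : xpow a = xpow (setPair i a (a (lo i)) 0) := by rw [setPair_eq_self i a rfl h.symm]
  rw [quasiRefl_xpow, quasiSwap, if_pos (Or.inr h), comp_simpleRefl, h, e]
  simp only [xpow_setPair, ← Finset.sum_mul]
  -- The factor of `θ̃ᵢ` in front of the geometric sum: `X (hi i)` divides every term because `p < a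
  -- (lo i)`.
  have e2 : ∑ p ∈ Finset.range (a (lo i)), (X (lo i) ^ p * X (hi i) ^ (a (lo i) - p) :
      MvPolynomial (Fin n) ℂ) = X (hi i) *
      ∑ p ∈ Finset.range (a (lo i)), X (lo i) ^ p * X (hi i) ^ (a (lo i) - 1 - p) := by
    rw [Finset.mul_sum]
    refine Finset.sum_congr rfl fun p hp => ?_
    have hp' := Finset.mem_range.mp hp
    rw [show a (lo i) - p = (a (lo i) - 1 - p) + 1 by omega, pow_succ]
    ring
  have e3 := geom_sum₂_mul (X (lo i) : MvPolynomial (Fin n) ℂ) (X (hi i)) (a (lo i))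
  rw [e2, ← sub_mul, pow_zero, pow_zero, mul_one, one_mul, ← e3]
  ring

/-- The quasisymmetric action exchanges the two monomials, so their sum is invariant. -/
theorem thetaOp_xpow_swap {n : ℕ} {i : Fin (n - 1)} {a : Fin n → ℕ}
    (h : a (lo i) = 0 ∨ a (hi i) = 0) :
    thetaOp i (xpow a) + thetaOp i (xpow (a ∘ simpleRefl i)) = 0 := by
  have h' : (a ∘ simpleRefl i) (lo i) = 0 ∨ (a ∘ simpleRefl i) (hi i) = 0 := by
    rw [comp_simpleRefl]
    simpa using h.symm
  have h2 : (a ∘ simpleRefl i) ∘ simpleRefl i = a := by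
    funext j
    simp [simpleRefl]
  rw [← eq_neg_iff_add_eq_zero]
  apply thetaOp_eq_of_mul_eq
  have := divDiff_spec i (xpow (a ∘ simpleRefl i))
  rw [quasiRefl_xpow, quasiSwap, if_pos h', h2] at this
  rw [quasiRefl_xpow, quasiSwap, if_pos h, thetaOp]
  linear_combination X (hi i) * this

open Classical in
/-- The set of all `g` of size `N` with the property `P`. -/
def monoSet {n : ℕ} (N : ℕ) (P : (Fin n → ℕ) → Prop) : Finset (Fin n → ℕ) :=
  (Finset.univ.piAntidiag N).filter P

theorem mem_monoSet {n : ℕ} {N : ℕ} {P : (Fin n → ℕ) → Prop} {g : Fin n → ℕ} :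
    g ∈ monoSet N P ↔ ∑ j, g j = N ∧ P g := by
  simp [monoSet]

/-- The sum of the monomials `x^g` over all `g` of size `N` with the property `P`. -/
def monoSum {n : ℕ} (N : ℕ) (P : (Fin n → ℕ) → Prop) : MvPolynomial (Fin n) ℂ :=
  ∑ g ∈ monoSet N P, xpow g

theorem monoSum_congr {n : ℕ} {N : ℕ} {P Q : (Fin n → ℕ) → Prop}
    (h : ∀ g, ∑ j, g j = N → (P g ↔ Q g)) : monoSum N P = monoSum N Q := by
  refine Finset.sum_congr ?_ fun _ _ => rfl
  ext g
  simp only [mem_monoSet]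
  exact and_congr_right (h g)

theorem monoSum_or {n : ℕ} {N : ℕ} {P Q : (Fin n → ℕ) → Prop} (h : ∀ g, P g → ¬ Q g) :
    monoSum N (fun g => P g ∨ Q g) = monoSum N P + monoSum N Q := by
  classical
  unfold monoSum
  rw [← Finset.sum_union (Finset.disjoint_left.mpr fun g h1 h2 =>
    h g (mem_monoSet.mp h1).2 (mem_monoSet.mp h2).2)]
  refine Finset.sum_congr ?_ fun _ _ => rfl
  ext g
  simp only [mem_monoSet, Finset.mem_union, and_or_left]

theorem sum_setPair {n : ℕ} (i : Fin (n - 1)) (a : Fin n → ℕ) {p q : ℕ}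
    (h : p + q = a (lo i) + a (hi i)) : ∑ j, setPair i a p q j = ∑ j, a j := by
  rw [← psum_self, ← psum_self]
  refine psum_congr i (fun j h1 h2 => setPair_of_ne i a p q h1 h2) (by simpa using h) ?_
  have := i.2
  omega

/-- The effect of `θ̃ᵢ` on a sum of monomials without `xᵢ₊₁`. -/
theorem thetaOp_monoSum {n : ℕ} (i : Fin (n - 1)) (N : ℕ) (P : (Fin n → ℕ) → Prop)
    (hP : ∀ g, P g → g (hi i) = 0) :
    thetaOp i (monoSum N P) = monoSum N fun g => g (hi i) ≠ 0 ∧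
      P (setPair i g (g (lo i) + g (hi i)) 0) := by
  unfold monoSum
  rw [thetaOp_sum, Finset.sum_congr rfl fun g hg =>
    thetaOp_xpow_of_hi_eq_zero (hP g (mem_monoSet.mp hg).2), Finset.sum_sigma']
  -- A pair `(g, p)` is one term of a geometric sum. The new exponent determines it: `p` is its
  -- entry at `lo i`, and `g` arises by moving the entry at `hi i` back.
  refine Finset.sum_bij' (fun x _ => setPair i x.1 x.2 (x.1 (lo i) - x.2))
    (fun g _ => ⟨setPair i g (g (lo i) + g (hi i)) 0, g (lo i)⟩) ?_ ?_ ?_ ?_ ?_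
  · rintro ⟨g, p⟩ hx
    simp only [Finset.mem_sigma, mem_monoSet, Finset.mem_range] at hx ⊢
    obtain ⟨⟨hN, hg⟩, hp⟩ := hx
    have h0 := hP g hg
    refine ⟨?_, by simp; omega, ?_⟩
    · rw [sum_setPair i g (by omega), hN]
    · rw [setPair_lo, setPair_hi, setPair_setPair, setPair_eq_self i g (by omega) h0.symm]
      exact hg
  · intro g hx
    simp only [Finset.mem_sigma, mem_monoSet, Finset.mem_range] at hx ⊢
    obtain ⟨hN, h1, hg⟩ := hx
    refine ⟨⟨?_, hg⟩, by simp; omega⟩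
    rw [sum_setPair i g (by omega), hN]
  · rintro ⟨g, p⟩ hx
    simp only [Finset.mem_sigma, mem_monoSet, Finset.mem_range] at hx ⊢
    obtain ⟨⟨hN, hg⟩, hp⟩ := hx
    have h0 := hP g hg
    rw [setPair_lo, setPair_hi, setPair_setPair, setPair_eq_self i g (by omega) h0.symm]
  · intro g hx
    simp only
    rw [setPair_setPair, setPair_lo, setPair_eq_self i g rfl (by omega)]
  · intro g hx
    rfl

/-! ### The exponents of atoms and slides -/

/-- `g` is the exponent of a monomial of the fundamental atom of `a`. -/
structure AtomP {n : ℕ} (a g : Fin n → ℕ) : Prop where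
  dom : ∀ k, psum a k ≤ psum g k
  total : psum g n = psum a n
  block : ∀ i : Fin n, a i ≠ 0 → psum g ((i : ℕ) + 1) = psum a ((i : ℕ) + 1) ∧ g i ≠ 0

/-- `g` is the exponent of a monomial of the fundamental slide polynomial of `a`. -/
structure SlideP {n : ℕ} (a g : Fin n → ℕ) : Prop where
  dom : ∀ k, psum a k ≤ psum g k
  total : psum g n = psum a n
  cut : ∀ k, ∃ m, psum g m = psum a k

/-! ### One exchange of a zero with its right neighbour -/

section Step

variable {n : ℕ} {i : Fin (n - 1)} {a : Fin n → ℕ}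

theorem psum_setPair_of_ne (g : Fin n → ℕ) {p q : ℕ} (h : p + q = g (lo i) + g (hi i)) {k : ℕ}
    (hk : k ≠ (i : ℕ) + 1) : psum (setPair i g p q) k = psum g k :=
  psum_congr i (fun _ h1 h2 => setPair_of_ne i g p q h1 h2) (by simpa using h) hk

theorem psum_setPair_mid (g : Fin n → ℕ) {p : ℕ} (h : p = g (lo i) + g (hi i)) :
    psum (setPair i g p 0) ((i : ℕ) + 1) = psum g ((i : ℕ) + 2) := by
  have h1 := psum_hi (setPair i g p 0) i
  rw [setPair_hi, psum_setPair_of_ne g (by omega) (by omega)] at h1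
  omega

theorem psum_self_setPair (g : Fin n → ℕ) {p q : ℕ} (h : p + q = g (lo i) + g (hi i)) :
    psum (setPair i g p q) n = psum g n :=
  psum_setPair_of_ne g h (by have := i.2; omega)

/-- Merging two neighbouring entries into the left one changes only the prefix sum between them, to
the one after both. So the block equation at `hi i` becomes the one at `lo i`; that `g (hi i)` is
nonzero is lost and has to be kept separately. Dominance at the middle cut is free, since `a (lo i)
= 0`. -/
theorem atomP_step (h0 : a (lo i) = 0) (h1 : a (hi i) ≠ 0) (g : Fin n → ℕ) :
    AtomP a g ↔ g (hi i) ≠ 0 ∧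
      AtomP (setPair i a (a (hi i)) 0) (setPair i g (g (lo i) + g (hi i)) 0) := by
  have a1 : ∀ k, k ≠ (i : ℕ) + 1 → psum (setPair i a (a (hi i)) 0) k = psum a k :=
    fun k hk => psum_setPair_of_ne a (by omega) hk
  have a2 := psum_setPair_mid (i := i) a (p := a (hi i)) (by omega)
  have g1 : ∀ k, k ≠ (i : ℕ) + 1 → psum (setPair i g (g (lo i) + g (hi i)) 0) k = psum g k :=
    fun k hk => psum_setPair_of_ne g (by omega) hk
  have g2 := psum_setPair_mid (i := i) g (p := g (lo i) + g (hi i)) rfl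
  have a3 := psum_lo a i
  have a4 := psum_hi a i
  have g3 := psum_lo g i
  have g4 := psum_hi g i
  have a5 := psum_self_setPair (i := i) a (p := a (hi i)) (q := 0) (by omega)
  have g5 := psum_self_setPair (i := i) g (p := g (lo i) + g (hi i)) (q := 0) (by omega)
  have hval : ∀ j : Fin n, j ≠ lo i → (j : ℕ) + 1 ≠ (i : ℕ) + 1 := by
    intro j hj h
    exact hj (Fin.ext (by rw [lo_val]; omega))
  constructor
  · intro h
    obtain ⟨b1, b2⟩ := h.block (hi i) h1
    rw [hi_val] at b1
    refine ⟨b2, fun k => ?_, ?_, fun j hj => ?_⟩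
    · by_cases hk : k = (i : ℕ) + 1
      · rw [hk, a2, g2]; exact h.dom _
      · rw [a1 k hk, g1 k hk]; exact h.dom _
    · rw [a5, g5, h.total]
    · by_cases e1 : j = lo i
      · subst e1
        rw [lo_val, a2, g2, setPair_lo]
        exact ⟨b1, by omega⟩
      by_cases e2 : j = hi i
      · subst e2; simp at hj
      · rw [setPair_of_ne i _ _ _ e1 e2] at hj ⊢
        rw [a1 _ (hval j e1), g1 _ (hval j e1)]
        exact h.block j hj
  · rintro ⟨b2, h⟩
    have b1 := (h.block (lo i) (by simpa using h1)).1
    rw [lo_val, a2, g2] at b1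
    refine ⟨fun k => ?_, ?_, fun j hj => ?_⟩
    · by_cases hk : k = (i : ℕ) + 1
      · have := h.dom i
        rw [a1 i (by omega), g1 i (by omega)] at this
        rw [hk]; omega
      · rw [← a1 k hk, ← g1 k hk]; exact h.dom _
    · rw [← a5, ← g5, h.total]
    · by_cases e1 : j = lo i
      · exact absurd (e1 ▸ h0) hj
      by_cases e2 : j = hi i
      · subst e2
        exact ⟨b1, b2⟩
      · have := h.block j (by rwa [setPair_of_ne i _ _ _ e1 e2])
        rwa [setPair_of_ne i _ _ _ e1 e2, a1 _ (hval j e1), g1 _ (hval j e1)] at this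

/-- Every exponent on the left is nonzero at `lo i`. Those also nonzero at `hi i` are killed; the
others expand without cancellation, as in `atomP_step`. -/
theorem thetaOp_atom (h0 : a (lo i) = 0) (h1 : a (hi i) ≠ 0) (N : ℕ) :
    thetaOp i (monoSum N (AtomP (a ∘ simpleRefl i))) = monoSum N (AtomP a) := by
  rw [comp_simpleRefl, h0, monoSum_congr (P := AtomP a) fun g _ => atomP_step h0 h1 g]
  set a' := setPair i a (a (hi i)) 0
  have hsplit : monoSum N (AtomP a') =
      monoSum N (fun g => AtomP a' g ∧ g (hi i) ≠ 0) +
        monoSum N (fun g => AtomP a' g ∧ g (hi i) = 0) := by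
    rw [← monoSum_or fun g h h' => h.2 h'.2]
    exact monoSum_congr fun g _ => by tauto
  rw [hsplit]
  change thetaHom i (_ + _) = _
  rw [map_add]
  change thetaOp i _ + thetaOp i _ = _
  rw [thetaOp_monoSum i N (fun g => AtomP a' g ∧ g (hi i) = 0) fun g h => h.2]
  have hz : thetaOp i (monoSum N fun g => AtomP a' g ∧ g (hi i) ≠ 0) = 0 := by
    unfold monoSum
    rw [thetaOp_sum]
    refine Finset.sum_eq_zero fun g hg => ?_
    have hg := (mem_monoSet.mp hg).2
    exact thetaOp_xpow_of_ne_zero (hg.1.block (lo i) (by simpa [a'] using h1)).2 hg.2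
  rw [hz, zero_add]
  exact monoSum_congr fun g _ => by simp

theorem SlideP.cut_of_eq {b g h : Fin n → ℕ} {p : ℕ} (hb : SlideP b g)
    (h1 : ∀ k, k ≠ p → psum h k = psum g k) (h2 : ∃ m, psum h m = psum g p) (k : ℕ) :
    ∃ m, psum h m = psum b k := by
  obtain ⟨m, hm⟩ := hb.cut k
  by_cases hmp : m = p
  · obtain ⟨m', hm'⟩ := h2
    exact ⟨m', by rw [hm', ← hmp, hm]⟩
  · exact ⟨m, by rw [h1 m hmp, hm]⟩

/-- Only the middle prefix sum changes. Its old value survives at a neighbouring cut because one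
entry is zero, and `hb` secures dominance in either order. -/
theorem slideP_swap {b g : Fin n → ℕ} (hg : SlideP b g) (h : g (lo i) = 0 ∨ g (hi i) = 0)
    (hb : psum b ((i : ℕ) + 1) ≤ psum g i) : SlideP b (g ∘ simpleRefl i) := by
  rw [comp_simpleRefl]
  have g1 : ∀ k, k ≠ (i : ℕ) + 1 → psum (setPair i g (g (hi i)) (g (lo i))) k = psum g k :=
    fun k hk => psum_setPair_of_ne g (by omega) hk
  have g3 := psum_lo g i
  have g4 := psum_hi g i
  refine ⟨fun k => ?_, ?_, hg.cut_of_eq g1 ?_⟩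
  · by_cases hk : k = (i : ℕ) + 1
    · have := psum_mono (setPair i g (g (hi i)) (g (lo i))) (Nat.le_succ i)
      rw [g1 i (by omega)] at this
      rw [hk]
      exact hb.trans this
    · rw [g1 k hk]; exact hg.dom _
  · rw [psum_self_setPair (i := i) g (by omega), hg.total]
  · rcases h with h | h
    · exact ⟨i, by rw [g1 i (by omega)]; omega⟩
    · exact ⟨i + 2, by rw [g1 _ (by omega)]; omega⟩

/-- The case split is whether `psum g (i + 1)` already reaches `psum a (i + 2)`. If not, `g (hi i)`
is positive and merging gives the second alternative. Its last inequality makes the alternatives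
exclusive. -/
theorem slideP_step (h0 : a (lo i) = 0) (g : Fin n → ℕ) :
    SlideP a g ↔ SlideP (setPair i a (a (hi i)) 0) g ∨ (g (hi i) ≠ 0 ∧
      SlideP (setPair i a (a (hi i)) 0) (setPair i g (g (lo i) + g (hi i)) 0) ∧
      psum g i < psum a ((i : ℕ) + 2)) := by
  have a1 : ∀ k, k ≠ (i : ℕ) + 1 → psum (setPair i a (a (hi i)) 0) k = psum a k :=
    fun k hk => psum_setPair_of_ne a (by omega) hk
  have a2 := psum_setPair_mid (i := i) a (p := a (hi i)) (by omega)
  have g1 : ∀ k, k ≠ (i : ℕ) + 1 → psum (setPair i g (g (lo i) + g (hi i)) 0) k = psum g k :=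
    fun k hk => psum_setPair_of_ne g (by omega) hk
  have g2 := psum_setPair_mid (i := i) g (p := g (lo i) + g (hi i)) rfl
  have a3 := psum_lo a i
  have a4 := psum_hi a i
  have g3 := psum_lo g i
  have g4 := psum_hi g i
  have a5 := psum_self_setPair (i := i) a (p := a (hi i)) (q := 0) (by omega)
  have g5 := psum_self_setPair (i := i) g (p := g (lo i) + g (hi i)) (q := 0) (by omega)
  have a6 : ∀ k, ∃ m, psum (setPair i a (a (hi i)) 0) k = psum a m := by
    intro k
    by_cases hk : k = (i : ℕ) + 1
    · exact ⟨_, hk ▸ a2⟩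
    · exact ⟨k, a1 k hk⟩
  have a7 : ∀ k, ∃ m, psum a k = psum (setPair i a (a (hi i)) 0) m := by
    intro k
    by_cases hk : k = (i : ℕ) + 1
    · exact ⟨i, by rw [a1 i (by omega), hk]; omega⟩
    · exact ⟨k, (a1 k hk).symm⟩
  constructor
  · intro h
    have hi1 := h.dom i
    have hi2 := h.dom (i + 2)
    by_cases hS : psum a ((i : ℕ) + 2) ≤ psum g ((i : ℕ) + 1)
    · refine Or.inl ⟨fun k => ?_, ?_, fun k => ?_⟩
      · by_cases hk : k = (i : ℕ) + 1
        · rw [hk, a2]; exact hS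
        · rw [a1 k hk]; exact h.dom _
      · rw [a5, h.total]
      · obtain ⟨m, hm⟩ := a6 k
        rw [hm]; exact h.cut m
    · refine Or.inr ⟨by omega, ⟨fun k => ?_, ?_, fun k => ?_⟩, by omega⟩
      · by_cases hk : k = (i : ℕ) + 1
        · rw [hk, a2, g2]; exact h.dom _
        · rw [a1 k hk, g1 k hk]; exact h.dom _
      · rw [a5, g5, h.total]
      · obtain ⟨m, hm⟩ := a6 k
        rw [hm]
        obtain ⟨m', hm'⟩ := h.cut m
        -- Merging can destroy only the prefix sum at `i + 1`. If that cut was used, then `m ≤ i +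
        -- 1`, and `a (lo i) = 0` squeezes the value down to `psum g i`, which survives.
        by_cases hk : m' = (i : ℕ) + 1
        · refine ⟨i, ?_⟩
          rw [g1 i (by omega)]
          have hm2 : m ≤ i + 1 := by
            by_contra hm2
            have := psum_mono a (show (i : ℕ) + 2 ≤ m by omega)
            rw [hk] at hm'
            omega
          have := psum_mono a hm2
          rw [hk] at hm'
          omega
        · exact ⟨m', by rw [g1 m' hk, hm']⟩
  · rintro (h | ⟨b1, h, b2⟩)
    · have hi1 := h.dom i
      rw [a1 i (by omega)] at hi1
      refine ⟨fun k => ?_, ?_, fun k => ?_⟩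
      · by_cases hk : k = (i : ℕ) + 1
        · rw [hk]; omega
        · rw [← a1 k hk]; exact h.dom _
      · rw [← a5, h.total]
      · obtain ⟨m, hm⟩ := a7 k
        rw [hm]; exact h.cut m
    · have hi1 := h.dom i
      rw [a1 i (by omega), g1 i (by omega)] at hi1
      refine ⟨fun k => ?_, ?_, fun k => ?_⟩
      · by_cases hk : k = (i : ℕ) + 1
        · rw [hk]; omega
        · rw [← a1 k hk, ← g1 k hk]; exact h.dom _
      · rw [← a5, ← g5, h.total]
      · obtain ⟨m, hm⟩ := a7 k
        rw [hm]
        exact h.cut_of_eq (fun k hk => (g1 k hk).symm) ⟨_, g2.symm⟩ m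

/-- The identity part of `π̃ᵢ` yields the first alternative of `slideP_step`. In the part `θ̃ᵢ`,
exponents with a nonzero entry at `hi i` or a large prefix sum vanish or cancel in pairs; the rest
expand to the second alternative. -/
theorem piOp_slide (h0 : a (lo i) = 0) (N : ℕ) :
    piOp i (monoSum N (SlideP (a ∘ simpleRefl i))) = monoSum N (SlideP a) := by
  have a2 := psum_setPair_mid (i := i) a (p := a (hi i)) (by omega)
  rw [comp_simpleRefl, h0, monoSum_congr (P := SlideP a) fun g _ => slideP_step h0 g]
  set a' := setPair i a (a (hi i)) 0
  have hsplit : monoSum N (SlideP a') =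
      monoSum N (fun g => SlideP a' g ∧ (g (hi i) ≠ 0 ∨ psum a ((i : ℕ) + 2) ≤ psum g i)) +
        monoSum N (fun g => SlideP a' g ∧ g (hi i) = 0 ∧ psum g i < psum a ((i : ℕ) + 2)) := by
    rw [← monoSum_or]
    · refine monoSum_congr fun g _ => ?_
      have := Nat.lt_or_ge (psum g i) (psum a ((i : ℕ) + 2))
      tauto
    · rintro g ⟨-, h⟩ ⟨-, h1, h2⟩
      omega
  have hθ : thetaOp i (monoSum N (SlideP a')) = monoSum N (fun g => g (hi i) ≠ 0 ∧
      SlideP a' (setPair i g (g (lo i) + g (hi i)) 0) ∧ psum g i < psum a ((i : ℕ) + 2)) := by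
    rw [hsplit]
    change thetaHom i (_ + _) = _
    rw [map_add]
    change thetaOp i _ + thetaOp i _ = _
    rw [thetaOp_monoSum i N (fun g => SlideP a' g ∧ g (hi i) = 0 ∧
      psum g i < psum a ((i : ℕ) + 2)) fun g h => h.2.1]
    have hz : thetaOp i (monoSum N
        fun g => SlideP a' g ∧ (g (hi i) ≠ 0 ∨ psum a ((i : ℕ) + 2) ≤ psum g i)) = 0 := by
      unfold monoSum
      rw [thetaOp_sum]
      have hadd : ∀ g : Fin n → ℕ,
          thetaOp i (xpow g) + thetaOp i (xpow (quasiSwap i g)) = 0 := by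
        intro g
        unfold quasiSwap
        split_ifs with h
        · exact thetaOp_xpow_swap h
        · push Not at h
          rw [thetaOp_xpow_of_ne_zero h.1 h.2, add_zero]
      refine Finset.sum_involution (fun g _ => quasiSwap i g) (fun g _ => hadd g) ?_ ?_ ?_
      · intro g _ hne e
        have := hadd g
        rw [e, ← two_mul] at this
        exact hne ((mul_eq_zero.mp this).resolve_left two_ne_zero)
      · intro g hg
        rw [mem_monoSet] at hg ⊢
        unfold quasiSwap
        split_ifs with h
        · obtain ⟨hN, hs, hg⟩ := hg
          -- If `g (hi i) ≠ 0`, then `g (lo i) = 0`, and dominance already gives the large prefix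
          -- sum. That condition is stable under the exchange.
          have e1 := hs.dom (i + 1)
          have e2 := psum_lo g i
          rw [a2] at e1
          have hS : psum a ((i : ℕ) + 2) ≤ psum g i := by omega
          refine ⟨?_, slideP_swap hs h (by rw [a2]; exact hS), Or.inr ?_⟩
          · rw [comp_simpleRefl, sum_setPair i g (by omega), hN]
          · rwa [comp_simpleRefl, psum_setPair_of_ne g (by omega) (by omega)]
        · exact hg
      · intro g _
        unfold quasiSwap
        have hss : (g ∘ simpleRefl i) ∘ simpleRefl i = g := by
          funext j
          simp [simpleRefl]
        have hlo : (g ∘ simpleRefl i) (lo i) = g (hi i) := by simp [simpleRefl]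
        have hhi : (g ∘ simpleRefl i) (hi i) = g (lo i) := by simp [simpleRefl]
        by_cases h : g (lo i) = 0 ∨ g (hi i) = 0
        · rw [if_pos h, hlo, hhi, if_pos h.symm, hss]
        · rw [if_neg h, if_neg h]
    rw [hz, zero_add]
    refine monoSum_congr fun g _ => ?_
    rw [psum_setPair_of_ne g (by omega) (by omega), setPair_hi]
    simp
  rw [piOp, hθ, ← monoSum_or]
  -- Disjointness: the merged exponent has a cut of value `psum a (i + 2)`. By `b2` it lies after
  -- `i`, so its value is at least `psum g (i + 2)`, which exceeds `psum g (i + 1)` and hence `psum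
  -- a (i + 2)`.
  rintro g h ⟨b1, h', b2⟩
  have e1 := h.dom (i + 1)
  obtain ⟨m, hm⟩ := h'.cut (i + 1)
  have e2 := h'.dom (i + 1)
  have g2 := psum_setPair_mid (i := i) g (p := g (lo i) + g (hi i)) rfl
  have g1 := psum_setPair_of_ne (i := i) g (p := g (lo i) + g (hi i)) (q := 0) rfl
    (k := i) (by omega)
  have g4 := psum_hi g i
  have hmi : (i : ℕ) + 1 ≤ m := by
    by_contra hmi
    have := psum_mono (setPair i g (g (lo i) + g (hi i)) 0) (show m ≤ i by omega)
    omega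
  have := psum_mono (setPair i g (g (lo i) + g (hi i)) 0) hmi
  omega

end Step

/-! ### Reduced words of the flattening permutation -/

/-- The sum of the (zero-based) positions of the nonzero entries. -/
def posSum {n : ℕ} (a : Fin n → ℕ) : ℕ := ∑ j : Fin n, if a j = 0 then 0 else (j : ℕ)

theorem posSum_eq {n : ℕ} (i : Fin (n - 1)) (a : Fin n → ℕ) :
    posSum a = (if a (lo i) = 0 then 0 else (i : ℕ)) + ((if a (hi i) = 0 then 0 else (i : ℕ) + 1) +
      ∑ j ∈ (Finset.univ.erase (lo i)).erase (hi i), if a j = 0 then 0 else (j : ℕ)) := by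
  rw [posSum, ← Finset.add_sum_erase _ _ (Finset.mem_univ (lo i)),
    ← Finset.add_sum_erase _ _ (Finset.mem_erase.mpr ⟨(lo_ne_hi i).symm, Finset.mem_univ _⟩),
    lo_val, hi_val]

theorem posSum_comp_simpleRefl {n : ℕ} (i : Fin (n - 1)) (a : Fin n → ℕ) :
    posSum (a ∘ simpleRefl i) + (if a (hi i) = 0 then 0 else 1) =
      posSum a + if a (lo i) = 0 then 0 else 1 := by
  rw [posSum_eq i, posSum_eq i a]
  have e : ∑ j ∈ (Finset.univ.erase (lo i)).erase (hi i),
      (if (a ∘ simpleRefl i) j = 0 then 0 else (j : ℕ)) =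
      ∑ j ∈ (Finset.univ.erase (lo i)).erase (hi i), if a j = 0 then 0 else (j : ℕ) := by
    refine Finset.sum_congr rfl fun j hj => ?_
    simp only [Finset.mem_erase] at hj
    rw [comp_simpleRefl, setPair_of_ne i _ _ _ hj.2.1 hj.1]
  rw [e, comp_simpleRefl, setPair_lo, setPair_hi]
  split_ifs <;> omega

theorem wordPerm_cons {n : ℕ} (i : Fin (n - 1)) (l : List (Fin (n - 1))) :
    wordPerm (i :: l) = simpleRefl i * wordPerm l := by simp [wordPerm]

theorem comp_wordPerm_cons {n : ℕ} (a : Fin n → ℕ) (i : Fin (n - 1)) (l : List (Fin (n - 1))) :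
    a ∘ wordPerm (i :: l) = (a ∘ simpleRefl i) ∘ wordPerm l := by
  rw [wordPerm_cons]; rfl

theorem wordPerm_reverse {n : ℕ} (l : List (Fin (n - 1))) :
    wordPerm l.reverse = (wordPerm l)⁻¹ := by
  rw [wordPerm, wordPerm, List.map_reverse, List.prod_inv_reverse, List.map_map]
  congr 3

/-- One letter lowers `posSum` by at most one, which bounds the length of a flattening word from
below. -/
theorem posSum_le_add_length {n : ℕ} (l : List (Fin (n - 1))) (a : Fin n → ℕ) :
    posSum a ≤ posSum (a ∘ wordPerm l) + l.length := by
  induction l generalizing a with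
  | nil => simp [wordPerm]
  | cons i l ih =>
    have h := ih (a ∘ simpleRefl i)
    have h2 := posSum_comp_simpleRefl i a
    rw [comp_wordPerm_cons, List.length_cons]
    split_ifs at h2 <;> omega

/-- A word that moves the nonzero entries as fast as possible consists of exchanges of a zero
with a nonzero entry to its right. -/
theorem foldr_eq_of_length_le {n : ℕ} {M : Type*} (op : Fin (n - 1) → M → M)
    (F : (Fin n → ℕ) → M)
    (step : ∀ i a, a (lo i) = 0 → a (hi i) ≠ 0 → op i (F (a ∘ simpleRefl i)) = F a)
    (l : List (Fin (n - 1))) (a : Fin n → ℕ)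
    (h : posSum (a ∘ wordPerm l) + l.length ≤ posSum a) :
    l.foldr op (F (a ∘ wordPerm l)) = F a := by
  induction l generalizing a with
  | nil => simp [wordPerm]
  | cons i l ih =>
    rw [comp_wordPerm_cons, List.length_cons] at h
    have h1 := posSum_le_add_length l (a ∘ simpleRefl i)
    have h2 := posSum_comp_simpleRefl i a
    -- There is no slack in the length bound, so the first letter lowers `posSum`. This happens only
    -- at a zero followed by a nonzero entry.
    rw [comp_wordPerm_cons, List.foldr_cons, ih _ (by split_ifs at h2 <;> omega)]
    apply step <;> split_ifs at h2 <;> first | assumption | omega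

theorem flatList_comp_simpleRefl {n : ℕ} (i : Fin (n - 1)) (a : Fin n → ℕ)
    (h : a (lo i) = 0 ∨ a (hi i) = 0) : flatList (a ∘ simpleRefl i) = flatList a := by
  have key : ∀ b : Fin n → ℕ, List.ofFn b = (List.ofFn b).take i ++
      b (lo i) :: b (hi i) :: (List.ofFn b).drop ((i : ℕ) + 2) := by
    intro b
    have h1 : (i : ℕ) + 1 < (List.ofFn b).length := by
      rw [List.length_ofFn]; have := i.2; omega
    conv_lhs => rw [← List.take_append_drop i (List.ofFn b), List.drop_eq_getElem_cons (by omega),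
      List.drop_eq_getElem_cons h1]
    simp only [List.getElem_ofFn]
    rfl
  have e1 : (List.ofFn (a ∘ simpleRefl i)).take i = (List.ofFn a).take i := by
    refine List.ext_getElem (by simp) fun m h1 h2 => ?_
    have h3 : m < (i : ℕ) := by rw [List.length_take] at h1; omega
    simp only [List.getElem_take, List.getElem_ofFn, comp_simpleRefl]
    apply setPair_of_ne <;> intro e <;> have := congrArg Fin.val e <;>
      simp only [lo_val, hi_val] at this <;> omega
  have e2 : (List.ofFn (a ∘ simpleRefl i)).drop ((i : ℕ) + 2) =
      (List.ofFn a).drop ((i : ℕ) + 2) := by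
    refine List.ext_getElem (by simp) fun m h1 h2 => ?_
    simp only [List.getElem_drop, List.getElem_ofFn, comp_simpleRefl]
    apply setPair_of_ne <;> intro e <;> have := congrArg Fin.val e <;>
      simp only [lo_val, hi_val] at this <;> omega
  rw [flatList, flatList, key a, key (a ∘ simpleRefl i), e1, e2, comp_simpleRefl, setPair_lo,
    setPair_hi]
  simp only [List.filter_append, List.filter_cons]
  rcases h with h | h <;> simp [h]

/-- Only a tail of zeros is removed, and the default value `0` restores it. -/
theorem filter_getD_of_pairwise {l : List ℕ} (h : l.Pairwise fun x y => x = 0 → y = 0) (k : ℕ) :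
    (l.filter (· ≠ 0)).getD k 0 = l.getD k 0 := by
  induction l generalizing k with
  | nil => simp
  | cons x l ih =>
    rw [List.pairwise_cons] at h
    by_cases hx : x = 0
    · have h0 : ∀ y ∈ x :: l, y = 0 := by
        rintro y (_ | ⟨_, hy⟩)
        · exact hx
        · exact h.1 y hy hx
      have e : (x :: l).filter (· ≠ 0) = [] := by
        rw [List.filter_eq_nil_iff]
        intro y hy
        simp [h0 y hy]
      rw [e, List.getD_nil]
      by_cases hk : k < (x :: l).length
      · rw [List.getD_eq_getElem _ _ hk]
        exact (h0 _ (List.getElem_mem hk)).symm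
      · rw [List.getD_eq_default _ _ (by omega)]
    · rw [List.filter_cons_of_pos (by simpa using hx)]
      cases k with
      | zero => simp
      | succ k => simpa using ih h.2 k

theorem eq_flat_of_forall {n : ℕ} {a : Fin n → ℕ}
    (h : ∀ i : Fin (n - 1), a (lo i) = 0 → a (hi i) = 0) : a = flat a := by
  have h1 : ∀ (d : ℕ) (j k : Fin n), (k : ℕ) = j + d → a j = 0 → a k = 0 := by
    intro d
    induction d with
    | zero => intro j k e hj; rwa [show k = j from Fin.ext e]
    | succ d ih =>
      intro j k e hj
      have hk := k.2
      exact (congrArg a (Fin.ext (by rw [hi_val]; simp only; omega))).trans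
        (h ⟨j + d, by omega⟩ (ih j _ rfl hj))
  funext i
  have hp : (List.ofFn a).Pairwise fun x y => x = 0 → y = 0 := by
    rw [List.pairwise_ofFn]
    intro j k hjk
    exact h1 (k - j) j k (by have : (j : ℕ) < k := hjk; omega)
  rw [flat, flatList, filter_getD_of_pairwise hp,
    List.getD_eq_getElem _ _ (by rw [List.length_ofFn]; exact i.2), List.getElem_ofFn]

/-- Bubble sort: each exchange of a zero with a nonzero right neighbour keeps the flat and lowers
`posSum` by one. -/
theorem exists_flat_word {n : ℕ} (a : Fin n → ℕ) : ∃ l : List (Fin (n - 1)),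
    a ∘ wordPerm l = flat a ∧ posSum (flat a) + l.length = posSum a := by
  induction h : posSum a using Nat.strong_induction_on generalizing a with
  | _ N ih =>
    by_cases hs : ∀ i : Fin (n - 1), a (lo i) = 0 → a (hi i) = 0
    · exact ⟨[], by simpa [wordPerm] using eq_flat_of_forall hs, by
        rw [← eq_flat_of_forall hs]; simpa using h⟩
    · push Not at hs
      obtain ⟨i, h0, h1⟩ := hs
      have h2 := posSum_comp_simpleRefl i a
      rw [if_neg h1, if_pos h0] at h2
      have hf : flat (a ∘ simpleRefl i) = flat a := by
        funext j
        rw [flat, flat, flatList_comp_simpleRefl i a (Or.inl h0)]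
      obtain ⟨l, hl1, hl2⟩ := ih _ (by omega) (a ∘ simpleRefl i) rfl
      rw [hf] at hl1 hl2
      exact ⟨i :: l, by rw [comp_wordPerm_cons, hl1], by rw [List.length_cons]; omega⟩

theorem reducedWord_spec {n : ℕ} (w : Equiv.Perm (Fin n)) : IsReducedWord w (reducedWord w) :=
  (exists_reducedWord w).choose_spec

theorem permLength_inv {n : ℕ} (w : Equiv.Perm (Fin n)) : permLength w⁻¹ = permLength w := by
  have h : ∀ w : Equiv.Perm (Fin n), permLength w⁻¹ ≤ permLength w := by
    intro w
    have := (reducedWord_spec w⁻¹).2 (reducedWord w).reverse (by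
      rw [wordPerm_reverse, (reducedWord_spec w).1])
    rwa [List.length_reverse] at this
  exact (h w).antisymm (by simpa using h w⁻¹)

/-- Minimality makes the chosen word no longer than that of `exists_flat_word`. This is the
hypothesis of `foldr_eq_of_length_le`, whichever reduced word was chosen. -/
theorem flatPerm_spec {n : ℕ} (a : Fin n → ℕ) :
    a ∘ wordPerm (reducedWord (flatPerm a)⁻¹) = flat a ∧
      posSum (flat a) + (reducedWord (flatPerm a)⁻¹).length ≤ posSum a := by
  obtain ⟨h1, h2⟩ := (exists_flatPerm a).choose_spec
  obtain ⟨l, hl1, hl2⟩ := exists_flat_word a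
  refine ⟨by rw [(reducedWord_spec _).1]; exact h1, ?_⟩
  have h3 := h2 (wordPerm l)⁻¹ (by rw [inv_inv]; exact hl1)
  have h4 := (reducedWord_spec (wordPerm l)).2 l rfl
  have h5 : (reducedWord (flatPerm a)⁻¹).length = permLength (flatPerm a) := permLength_inv _
  rw [permLength_inv] at h3
  have h6 : permLength (flatPerm a) ≤ permLength (wordPerm l) := h3
  have h7 : permLength (wordPerm l) = (reducedWord (wordPerm l)).length := rfl
  omega

/-! ### Monomial expansions of atoms and slides -/

theorem psum_total_of_zero {n : ℕ} {b : Fin n → ℕ} {m : ℕ}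
    (hb : ∀ j : Fin n, m ≤ (j : ℕ) → b j = 0) {k : ℕ} (hk : m ≤ k) : psum b k = psum b n := by
  have h : ∀ k, psum b k = psum b (min k m) := by
    intro k
    refine Finset.sum_congr rfl fun j _ => ?_
    by_cases hj : m ≤ (j : ℕ)
    · simp [hb j hj]
    · simp [show (j : ℕ) < m by omega]
  rw [h k, h n, min_eq_right hk]
  rcases le_total n m with h' | h'
  · rw [min_eq_left h', psum_of_le b h']
  · rw [min_eq_right h']

theorem psum_le_total {n : ℕ} (a : Fin n → ℕ) (k : ℕ) : psum a k ≤ psum a n := by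
  rcases le_total k n with h | h
  · exact psum_mono a h
  · rw [psum_of_le a h]

theorem flat_ne_zero_iff {n : ℕ} (a : Fin n → ℕ) (j : Fin n) :
    flat a j ≠ 0 ↔ (j : ℕ) < (flatList a).length := by
  rw [flat]
  by_cases h : (j : ℕ) < (flatList a).length
  · rw [List.getD_eq_getElem _ _ h]
    have := (List.mem_filter.mp (List.getElem_mem h)).2
    simp only [decide_eq_true_eq] at this
    exact ⟨fun _ => h, fun _ => this⟩
  · rw [List.getD_eq_default _ _ (by omega)]
    simp [h]

theorem slideP_refl {n : ℕ} (a : Fin n → ℕ) : SlideP a a :=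
  ⟨fun _ => le_rfl, rfl, fun k => ⟨k, rfl⟩⟩

theorem atomP_refl {n : ℕ} (a : Fin n → ℕ) : AtomP a a :=
  ⟨fun _ => le_rfl, rfl, fun _ hi => ⟨rfl, hi⟩⟩

/-- The block equations fix the prefix sums up to the last nonzero entry, and the total fixes the
rest. -/
theorem atomP_flat {n : ℕ} {a g : Fin n → ℕ} : AtomP (flat a) g ↔ g = flat a := by
  refine ⟨fun h => ?_, fun h => h ▸ atomP_refl _⟩
  have hz : ∀ j : Fin n, (flatList a).length ≤ (j : ℕ) → flat a j = 0 := fun j hj => by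
    by_contra hne
    exact absurd ((flat_ne_zero_iff a j).mp hne) (by omega)
  refine ext_of_psum fun k => le_antisymm ?_ (h.dom k)
  rcases k with _ | k
  · simp [psum_zero]
  by_cases hk : k + 1 ≤ (flatList a).length ∧ k < n
  · have := h.block ⟨k, hk.2⟩ ((flat_ne_zero_iff a _).mpr (by simp only; omega))
    exact this.1.le
  · have : psum (flat a) (k + 1) = psum (flat a) n := by
      by_cases h2 : k < n
      · exact psum_total_of_zero hz (by omega)
      · exact psum_of_le _ (by omega)
    rw [this, ← h.total]
    exact psum_le_total _ _

theorem slideP_flat {n : ℕ} {a g : Fin n → ℕ} : SlideP (flat a) g ↔ g = flat a := by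
  refine ⟨fun h => ?_, fun h => h ▸ slideP_refl _⟩
  have hz : ∀ j : Fin n, (flatList a).length ≤ (j : ℕ) → flat a j = 0 := fun j hj => by
    by_contra hne
    exact absurd ((flat_ne_zero_iff a j).mp hne) (by omega)
  -- Prefix sums of the flat strictly increase along its nonzero entries, so the cuts of `g`
  -- realizing them move strictly to the right. This bounds `psum g k` from above.
  have hc : ∀ k, k ≤ (flatList a).length → k ≤ n → ∃ m, k ≤ m ∧ psum g m = psum (flat a) k := by
    intro k
    induction k with
    | zero => exact fun _ _ => ⟨0, le_rfl, by simp [psum_zero]⟩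
    | succ k ih =>
      intro h1 h2
      obtain ⟨m, hm, e⟩ := ih (by omega) (by omega)
      obtain ⟨m', e'⟩ := h.cut (k + 1)
      refine ⟨m', ?_, e'⟩
      by_contra hlt
      have e1 := psum_mono g (show m' ≤ m by omega)
      have e2 := psum_succ (flat a) ⟨k, by omega⟩
      have e3 := (flat_ne_zero_iff a ⟨k, by omega⟩).mpr (by simp only; omega)
      simp only at e2
      omega
  refine ext_of_psum fun k => le_antisymm ?_ (h.dom k)
  by_cases hk : k ≤ (flatList a).length ∧ k ≤ n
  · obtain ⟨m, hm, e⟩ := hc k hk.1 hk.2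
    rw [← e]
    exact psum_mono g hm
  · have : psum (flat a) k = psum (flat a) n := by
      by_cases h2 : k ≤ n
      · exact psum_total_of_zero hz (by omega)
      · exact psum_of_le _ (by omega)
    rw [this, ← h.total]
    exact psum_le_total _ _

theorem monoSum_eq_xpow {n : ℕ} {P : (Fin n → ℕ) → Prop} {b : Fin n → ℕ}
    (h : ∀ g, P g ↔ g = b) : monoSum (∑ j, b j) P = xpow b := by
  unfold monoSum
  rw [show monoSet (∑ j, b j) P = {b} by
    ext g
    rw [mem_monoSet, h, Finset.mem_singleton]
    exact ⟨fun h => h.2, fun h => ⟨by rw [h], h⟩⟩]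
  exact Finset.sum_singleton _ _

theorem sum_flat {n : ℕ} (a : Fin n → ℕ) : ∑ j, flat a j = ∑ j, a j := by
  rw [← (flatPerm_spec a).1]
  exact Equiv.sum_comp (wordPerm (reducedWord (flatPerm a)⁻¹)) a

theorem fundamentalAtom_eq {n : ℕ} (a : Fin n → ℕ) :
    fundamentalAtom a = monoSum (∑ j, a j) (AtomP a) := by
  obtain ⟨h1, h2⟩ := flatPerm_spec a
  have h3 := foldr_eq_of_length_le thetaOp (fun b => monoSum (∑ j, a j) (AtomP b))
    (fun i b h0 h1 => thetaOp_atom h0 h1 _) (reducedWord (flatPerm a)⁻¹) a (by rw [h1]; exact h2)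
  rw [← h3, h1, ← sum_flat a, monoSum_eq_xpow fun g => atomP_flat]
  rfl

theorem fundamentalSlide_eq {n : ℕ} (a : Fin n → ℕ) :
    fundamentalSlide a = monoSum (∑ j, a j) (SlideP a) := by
  obtain ⟨h1, h2⟩ := flatPerm_spec a
  have h3 := foldr_eq_of_length_le piOp (fun b => monoSum (∑ j, a j) (SlideP b))
    (fun i b h0 _ => piOp_slide h0 _) (reducedWord (flatPerm a)⁻¹) a (by rw [h1]; exact h2)
  rw [← h3, h1, ← sum_flat a, monoSum_eq_xpow fun g => slideP_flat]
  rfl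

/-! ### Dominance, refinement and the fundamental shift through prefix sums -/

theorem psum_eq_take {n : ℕ} (a : Fin n → ℕ) (k : ℕ) :
    psum a k = ((List.ofFn a).take k).sum := by
  rw [psum, ← Finset.sum_filter, List.sum_take_ofFn]

theorem sum_filter_ne_zero (l : List ℕ) : (l.filter (· ≠ 0)).sum = l.sum := by
  induction l with
  | nil => simp
  | cons y l ih =>
    by_cases hy : y = 0
    · rw [List.filter_cons_of_neg (by simpa using hy), ih, hy, List.sum_cons, zero_add]
    · rw [List.filter_cons_of_pos (by simpa using hy), List.sum_cons, List.sum_cons, ih]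

/-- Block ends are cuts of `g` at the prefix sums of `a`; zeros create no new prefix sums.
Conversely, the first nonzero part of `a` gives a cut of `g`, and the rest is handled by induction.
-/
theorem refines_filter_iff (g a : List ℕ) :
    Refines (g.filter (· ≠ 0)) (a.filter (· ≠ 0)) ↔
      g.sum = a.sum ∧ ∀ k, ∃ m, (g.take m).sum = (a.take k).sum := by
  constructor
  · intro h
    induction a generalizing g with
    | nil =>
      obtain ⟨L, h1, h2, h3⟩ := h
      have : L = [] := by simpa using h3
      subst this
      refine ⟨?_, fun k => ⟨0, by simp⟩⟩
      rw [← sum_filter_ne_zero g, ← h2]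
      rfl
    | cons x a ih =>
      by_cases hx : x = 0
      · subst hx
        obtain ⟨h1, h2⟩ := ih g (by simpa using h)
        refine ⟨by simpa using h1, fun k => ?_⟩
        cases k with
        | zero => exact ⟨0, by simp⟩
        | succ k => simpa using h2 k
      · rw [List.filter_cons_of_pos (by simpa using hx)] at h
        obtain ⟨L, h1, h2, h3⟩ := h
        rcases L with _ | ⟨l, L⟩
        · simp at h3
        rw [List.map_cons, List.cons.injEq] at h3
        rw [List.flatten_cons, eq_comm, List.filter_eq_append_iff] at h2
        obtain ⟨g1, g2, rfl, e1, e2⟩ := h2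
        obtain ⟨h4, h5⟩ := ih g2 ⟨L, fun l hl => h1 l (List.mem_cons_of_mem _ hl), e2.symm, h3.2⟩
        have hs : g1.sum = x := by
          rw [← h3.1, ← e1, sum_filter_ne_zero]
        refine ⟨by rw [List.sum_append, List.sum_cons, hs, h4], fun k => ?_⟩
        cases k with
        | zero => exact ⟨0, by simp⟩
        | succ k =>
          obtain ⟨m, hm⟩ := h5 k
          refine ⟨g1.length + m, ?_⟩
          rw [List.take_length_add_append, List.sum_append, hm, hs, List.take_succ_cons,
            List.sum_cons]
  · rintro ⟨h1, h2⟩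
    induction a generalizing g with
    | nil =>
      refine ⟨[], by simp, ?_, rfl⟩
      rw [List.sum_nil, List.sum_eq_zero_iff_forall_eq_nat] at h1
      rw [List.flatten_nil, eq_comm, List.filter_eq_nil_iff]
      intro x hx
      simp [h1 x hx]
    | cons x a ih =>
      by_cases hx : x = 0
      · subst hx
        have := ih g (by simpa using h1) fun k => by simpa using h2 (k + 1)
        simpa using this
      · obtain ⟨m, hm⟩ := h2 1
        rw [List.take_succ_cons, List.take_zero, List.sum_singleton] at hm
        have hsum : (g.take m).sum + (g.drop m).sum = g.sum := by
          rw [← List.sum_append, List.take_append_drop]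
        rw [List.sum_cons] at h1
        obtain ⟨L, l1, l2, l3⟩ := ih (g.drop m) (by omega) fun k => by
          obtain ⟨m', hm'⟩ := h2 (k + 1)
          rw [List.take_succ_cons, List.sum_cons] at hm'
          by_cases hmm : m ≤ m'
          · refine ⟨m' - m, ?_⟩
            have e : (g.take m').sum = (g.take m).sum + ((g.drop m).take (m' - m)).sum := by
              rw [← List.sum_append, ← List.take_add, Nat.add_sub_cancel' hmm]
            omega
          -- A cut before `m` has sum at most `x`, so here the prefix of `a` has sum zero.
          · refine ⟨0, ?_⟩
            have e : (g.take m).sum = (g.take m').sum + ((g.drop m').take (m - m')).sum := by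
              rw [← List.sum_append, ← List.take_add, Nat.add_sub_cancel' (by omega)]
            rw [List.take_zero, List.sum_nil]
            omega
        rw [List.filter_cons_of_pos (by simpa using hx)]
        refine ⟨(g.take m).filter (· ≠ 0) :: L, ?_, ?_, ?_⟩
        · rintro l (_ | ⟨_, hl⟩)
          · intro e
            have := sum_filter_ne_zero (g.take m)
            rw [e, List.sum_nil] at this
            omega
          · exact l1 l hl
        · rw [List.flatten_cons, l2, ← List.filter_append, List.take_append_drop]
        · rw [List.map_cons, sum_filter_ne_zero, hm, l3]

theorem slideP_iff {n : ℕ} (a g : Fin n → ℕ) :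
    SlideP a g ↔ DomLE a g ∧ Refines (flatList g) (flatList a) := by
  rw [domLE_iff, flatList, flatList, refines_filter_iff, List.sum_ofFn, List.sum_ofFn,
    ← psum_self, ← psum_self]
  simp only [← psum_eq_take]
  exact ⟨fun h => ⟨h.dom, h.total, h.cut⟩, fun h => ⟨h.1, h.2.1, h.2.2⟩⟩

theorem nextEntry_of_le {n : ℕ} (v : Fin n → ℕ) {k : ℕ} (h : n ≤ k) : nextEntry v k = 0 := by
  rw [nextEntry, List.drop_eq_nil_of_le (by rw [List.length_ofFn]; exact h)]
  rfl

theorem nextEntry_eq {n : ℕ} (v : Fin n → ℕ) (j : Fin n) :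
    nextEntry v j = if v j = 0 then nextEntry v ((j : ℕ) + 1) else v j := by
  rw [nextEntry, List.drop_eq_getElem_cons (by rw [List.length_ofFn]; exact j.2),
    List.getElem_ofFn]
  split_ifs with h
  · rw [List.filter_cons_of_neg (by simpa using h)]
    rfl
  · rw [List.filter_cons_of_pos (by simpa using h)]
    rfl

theorem nextEntry_spec {n : ℕ} (v : Fin n → ℕ) (k : ℕ) :
    (nextEntry v k = 0 ∧ psum v n = psum v k) ∨
      ∃ m : Fin n, k ≤ m ∧ nextEntry v k = v m ∧ v m ≠ 0 ∧ psum v m = psum v k := by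
  induction h : n - k generalizing k with
  | zero => exact Or.inl ⟨nextEntry_of_le v (by omega), (psum_of_le v (by omega)).symm⟩
  | succ d ih =>
    have hk : k < n := by omega
    have e1 := nextEntry_eq v ⟨k, hk⟩
    have e2 := psum_succ v ⟨k, hk⟩
    simp only at e1 e2
    by_cases h0 : v ⟨k, hk⟩ = 0
    · rw [if_pos h0] at e1
      rw [h0, add_zero] at e2
      rw [e1, ← e2]
      rcases ih (k + 1) (by omega) with h1 | ⟨m, hm, h1⟩
      · exact Or.inl h1
      · exact Or.inr ⟨m, by omega, h1⟩
    · rw [if_neg h0] at e1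
      exact Or.inr ⟨⟨k, hk⟩, le_rfl, e1, h0, rfl⟩

/-- All but one unit of the next entry moves to the start of the gap before it, so inside a gap the
prefix sum is ahead by that amount. At `k = 0` the first case holds vacuously; in a trailing gap the
truncated difference is `0`. -/
theorem psum_qshift {n : ℕ} (v : Fin n → ℕ) (k : ℕ) (hk : k ≤ n) :
    ((∀ j : Fin n, (j : ℕ) + 1 = k → v j ≠ 0) → psum (qshift v) k = psum v k) ∧
      ((∃ j : Fin n, (j : ℕ) + 1 = k ∧ v j = 0) →
        psum (qshift v) k = psum v k + (nextEntry v k - 1)) := by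
  induction k with
  | zero => simp [psum_zero]
  | succ k ih =>
    obtain ⟨ih1, ih2⟩ := ih (by omega)
    have e1 := nextEntry_eq v ⟨k, hk⟩
    have e2 := psum_succ v ⟨k, hk⟩
    have e3 := psum_succ (qshift v) ⟨k, hk⟩
    simp only at e1 e2 e3
    have hj : ∀ j : Fin n, (j : ℕ) + 1 = k + 1 ↔ j = ⟨k, hk⟩ :=
      fun j => ⟨fun h => Fin.ext (by simpa using h), fun h => by rw [h]⟩
    simp only [hj, forall_eq, exists_eq_left]
    have hprev : PrevNonzero v ⟨k, hk⟩ ↔ ∀ j : Fin n, (j : ℕ) + 1 = k → v j ≠ 0 := Iff.rfl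
    by_cases hp : PrevNonzero v ⟨k, hk⟩
    · have ih1 := ih1 (hprev.mp hp)
      constructor
      · intro h0
        rw [e3, e2, ih1, qshift, if_pos h0, if_pos hp]
      · intro h0
        rw [if_pos h0] at e1
        rw [e3, e2, ih1, qshift, if_neg (not_not.mpr h0), if_pos hp, h0, e1]
        simp
    · have ih2 := ih2 (by
        rw [hprev] at hp
        push Not at hp
        exact hp)
      constructor
      · intro h0
        rw [if_neg h0] at e1
        rw [e3, e2, ih2, qshift, if_pos h0, if_neg hp, e1]
        omega
      · intro h0
        rw [if_pos h0] at e1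
        rw [e3, e2, ih2, qshift, if_neg (not_not.mpr h0), if_neg hp, h0, e1]
        simp

/-- Just after a nonzero entry the two bounds coincide, which is the block equation. Just before it
the upper bound leaves at least one unit, so `g` is nonzero there. -/
theorem atomP_iff {n : ℕ} (a g : Fin n → ℕ) :
    AtomP a g ↔ DomLE a g ∧ DomLE g (qshift a) := by
  rw [domLE_iff, domLE_iff]
  have hprev : ∀ k, (∀ j : Fin n, (j : ℕ) + 1 = k → a j ≠ 0) ∨
      ∃ j : Fin n, (j : ℕ) + 1 = k ∧ a j = 0 := fun k => by
    by_cases h : ∃ j : Fin n, (j : ℕ) + 1 = k ∧ a j = 0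
    · exact Or.inr h
    · exact Or.inl fun j h1 h2 => h ⟨j, h1, h2⟩
  constructor
  · intro h
    refine ⟨h.dom, ?_⟩
    have hmain : ∀ k, k ≤ n → psum g k ≤ psum (qshift a) k := by
      intro k hk
      obtain ⟨h1, h2⟩ := psum_qshift a k hk
      rcases hprev k with hp | hp
      · rw [h1 hp]
        rcases k with _ | k
        · simp [psum_zero]
        · exact (h.block ⟨k, hk⟩ (hp ⟨k, hk⟩ rfl)).1.le
      · rw [h2 hp]
        rcases nextEntry_spec a k with ⟨-, e2⟩ | ⟨m, hm, e1, e2, e3⟩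
        · have := psum_le_total g k
          rw [h.total] at this
          omega
        · obtain ⟨b1, b2⟩ := h.block m e2
          have e4 := psum_succ a m
          have e5 := psum_succ g m
          have e6 := psum_mono g hm
          omega
    intro k
    rcases le_total k n with hk | hk
    · exact hmain k hk
    · rw [psum_of_le _ hk, psum_of_le _ hk]
      exact hmain n le_rfl
  · rintro ⟨h1, h2⟩
    refine ⟨h1, le_antisymm ?_ (h1 n), fun i hi => ?_⟩
    · refine (h2 n).trans ?_
      obtain ⟨h3, h4⟩ := psum_qshift a n le_rfl
      rcases hprev n with hp | hp
      · rw [h3 hp]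
      · rw [h4 hp, nextEntry_of_le a le_rfl]; simp
    · have e1 := (psum_qshift a (i + 1) i.2).1 fun j hj => by
        rwa [show j = i from Fin.ext (by omega)]
      have e2 := h2 (i + 1)
      have e3 := h1 (i + 1)
      have e4 := h2 i
      have e5 := psum_succ a i
      have e6 := psum_succ g i
      have e7 := nextEntry_eq a i
      rw [if_neg hi] at e7
      obtain ⟨h3, h4⟩ := psum_qshift a i i.2.le
      refine ⟨by omega, ?_⟩
      rcases hprev i with hp | hp
      · have := h3 hp; omega
      · have := h4 hp; omega

/-! ### Weak compositions as weakly increasing words of positions -/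

/-- The vector of multiplicities of a word of positions. -/
def cnt (n : ℕ) (P : List ℕ) : Fin n → ℕ := fun i => P.count (i : ℕ)

/-- The weakly increasing word of positions with given multiplicities. -/
def posWord {n : ℕ} (a : Fin n → ℕ) : List ℕ :=
  (List.finRange n).flatMap fun i => List.replicate (a i) (i : ℕ)

theorem lt_of_mem_posWord {n : ℕ} {a : Fin n → ℕ} {k : ℕ} (h : k ∈ posWord a) : k < n := by
  simp only [posWord, List.mem_flatMap, List.mem_replicate] at h
  obtain ⟨i, -, -, rfl⟩ := h
  exact i.2

theorem cnt_posWord {n : ℕ} (a : Fin n → ℕ) : cnt n (posWord a) = a := by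
  funext i
  rw [cnt, posWord, List.count_flatMap, ← Fin.sum_univ_def,
    Finset.sum_eq_single i (fun j _ hj => ?_) (fun h => absurd (Finset.mem_univ i) h)]
  · simp
  · simp [List.count_replicate, Fin.val_inj, hj]

theorem pairwise_posWord {n : ℕ} (a : Fin n → ℕ) : (posWord a).Pairwise (· ≤ ·) := by
  rw [posWord, List.pairwise_flatMap]
  refine ⟨fun i _ => ?_, ?_⟩
  · rw [List.pairwise_replicate]
    exact Or.inr le_rfl
  · refine (List.pairwise_lt_finRange n).imp fun {i j} hij x hx y hy => ?_
    rw [List.mem_replicate] at hx hy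
    rw [hx.2, hy.2]
    exact (Fin.lt_def.mp hij).le

theorem posWord_cnt {n : ℕ} {P : List ℕ} (h : P.Pairwise (· ≤ ·)) (hn : ∀ k ∈ P, k < n) :
    posWord (cnt n P) = P := by
  refine List.Perm.eq_of_pairwise (fun a b _ _ => le_antisymm) (pairwise_posWord _) h ?_
  rw [List.perm_iff_count]
  intro k
  by_cases hk : k < n
  · exact congrFun (cnt_posWord (cnt n P)) ⟨k, hk⟩
  · rw [List.count_eq_zero.mpr fun h => hk (lt_of_mem_posWord h),
      List.count_eq_zero.mpr fun h => hk (hn k h)]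

theorem psum_cnt {T : Type*} {n : ℕ} (f : T → ℕ) {Z : List T} (hn : ∀ x ∈ Z, f x < n) (k : ℕ) :
    psum (cnt n (Z.map f)) k = Z.countP (f · < k) := by
  induction Z with
  | nil => simp [psum, cnt]
  | cons x Z ih =>
    have e : ∀ j : Fin n, (if (j : ℕ) < k then cnt n ((x :: Z).map f) j else 0) =
        (if (j : ℕ) < k then cnt n (Z.map f) j else 0) +
          if j = ⟨f x, hn x List.mem_cons_self⟩ then (if f x < k then 1 else 0) else 0 := by
      intro j
      simp only [cnt, List.map_cons, List.count_cons, Fin.ext_iff, beq_iff_eq]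
      split_ifs <;> omega
    rw [psum, Finset.sum_congr rfl fun j _ => e j, Finset.sum_add_distrib, List.countP_cons,
      ← ih fun y hy => hn y (List.mem_cons_of_mem _ hy)]
    simp [psum]

/-- The letters with `f < k` form an initial segment. This translates between prefix sums and
positions of letters. -/
theorem lt_countP_iff {T : Type*} {f : T → ℕ} {Z : List T}
    (h : Z.Pairwise fun x y => f x ≤ f y) (k : ℕ) {t : ℕ} (ht : t < Z.length) :
    t < Z.countP (f · < k) ↔ f Z[t] < k := by
  induction Z generalizing t with
  | nil => simp at ht
  | cons x Z ih =>
    rw [List.pairwise_cons] at h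
    rw [List.countP_cons]
    by_cases hx : f x < k
    · cases t with
      | zero => simp [hx]
      | succ t =>
        simp only [hx, decide_true, if_true, Nat.add_lt_add_iff_right, List.getElem_cons_succ]
        exact ih h.2 (by simpa using ht)
    · have h0 : Z.countP (f · < k) = 0 := by
        rw [List.countP_eq_zero]
        intro y hy
        have := h.1 y hy
        simp only [decide_eq_true_eq]
        omega
      rw [h0]
      cases t with
      | zero => simp [hx]
      | succ t =>
        have := h.1 (Z[t]'(by simpa using ht)) (List.getElem_mem _)
        simp [hx]
        omega

/-! ### Slide and atom conditions for two position functions on one word -/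

section Positions

variable {T : Type*} {n : ℕ} {f g : T → ℕ} {Z : List T}

/-- Dominance says that each letter moves weakly left; the cut condition says that `f` jumps
wherever `g` does. -/
theorem slideP_cnt_iff (hf : Z.Pairwise fun x y => f x ≤ f y)
    (hg : Z.Pairwise fun x y => g x ≤ g y) (fn : ∀ x ∈ Z, f x < n) (gn : ∀ x ∈ Z, g x < n) :
    SlideP (cnt n (Z.map g)) (cnt n (Z.map f)) ↔
      (∀ x ∈ Z, f x ≤ g x) ∧ Z.Pairwise fun x y => g x < g y → f x < f y := by
  constructor
  · intro h
    constructor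
    · rw [List.forall_mem_iff_getElem]
      intro t ht
      have h1 := h.dom (g Z[t] + 1)
      rw [psum_cnt f fn, psum_cnt g gn] at h1
      have h2 := (lt_countP_iff hg (g Z[t] + 1) ht).mpr (Nat.lt_succ_self _)
      exact Nat.lt_succ_iff.mp ((lt_countP_iff hf _ ht).mp (h2.trans_le h1))
    · rw [List.pairwise_iff_getElem]
      intro s t hs ht _ hlt
      obtain ⟨m, hm⟩ := h.cut (g Z[t])
      rw [psum_cnt f fn, psum_cnt g gn] at hm
      have h1 := (lt_countP_iff hg (g Z[t]) hs).mpr hlt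
      have h2 := mt (lt_countP_iff hg (g Z[t]) ht).mp (lt_irrefl _)
      rw [← hm] at h1 h2
      rw [lt_countP_iff hf _ hs] at h1
      rw [lt_countP_iff hf _ ht] at h2
      omega
  · rintro ⟨h1, h2⟩
    refine ⟨fun k => ?_, ?_, fun k => ?_⟩
    · rw [psum_cnt f fn, psum_cnt g gn]
      refine List.countP_mono_left fun x hx hk => ?_
      have := h1 x hx
      simp only [decide_eq_true_eq] at hk ⊢
      omega
    · rw [psum_cnt f fn, psum_cnt g gn]
      refine List.countP_congr fun x hx => ?_
      simp [fn x hx, gn x hx]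
    · rw [psum_cnt g gn]
      -- The value of `g` jumps between letters `c - 1` and `c`, hence so does that of `f`; cutting
      -- at `f Z[c]` again leaves `c` letters.
      set c := Z.countP (g · < k) with hc
      by_cases hcl : c < Z.length
      · refine ⟨f Z[c], ?_⟩
        rw [psum_cnt f fn]
        apply le_antisymm
        · by_contra hlt
          exact absurd ((lt_countP_iff hf (f Z[c]) hcl).mp (by omega)) (lt_irrefl _)
        · by_contra hlt
          have h3 : Z.countP (f · < f Z[c]) < c := by omega
          have hs : c - 1 < Z.length := by omega
          have h4 := (lt_countP_iff hg k hs).mp (by omega)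
          have h5 := mt (lt_countP_iff hg k hcl).mpr (by omega)
          have h6 := List.pairwise_iff_getElem.mp h2 (c - 1) c hs hcl (by omega) (by omega)
          have h7 := (lt_countP_iff hf _ hs).mpr h6
          omega
      · refine ⟨n, ?_⟩
        rw [psum_cnt f fn, List.countP_eq_length.mpr (by simpa using fn)]
        exact le_antisymm (by omega) List.countP_le_length

theorem cnt_map_ne_zero {j : Fin n} : cnt n (Z.map f) j ≠ 0 ↔ ∃ x ∈ Z, f x = j := by
  rw [cnt, ← Nat.pos_iff_ne_zero, List.count_pos_iff, List.mem_map]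

/-- By the block equation at `j` the same letters satisfy `f ≤ j` and `g ≤ j`, so a letter with `f =
j` has `g = j`. Conversely, strictness keeps letters with `g > j` beyond such an anchor. -/
theorem atomP_cnt_iff (hf : Z.Pairwise fun x y => f x ≤ f y)
    (hg : Z.Pairwise fun x y => g x ≤ g y) (fn : ∀ x ∈ Z, f x < n) (gn : ∀ x ∈ Z, g x < n) :
    AtomP (cnt n (Z.map g)) (cnt n (Z.map f)) ↔
      ((∀ x ∈ Z, f x ≤ g x) ∧ Z.Pairwise fun x y => g x < g y → f x < f y) ∧
        ∀ x ∈ Z, ∃ y ∈ Z, f y = g x ∧ g y = g x := by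
  have hgm := fun {s t : ℕ} (hs : s < Z.length) (ht : t < Z.length) (h : s < t) =>
    List.pairwise_iff_getElem.mp hg s t hs ht h
  constructor
  · intro h
    have h1 : ∀ x ∈ Z, f x ≤ g x := by
      rw [List.forall_mem_iff_getElem]
      intro t ht
      have h1 := h.dom (g Z[t] + 1)
      rw [psum_cnt f fn, psum_cnt g gn] at h1
      have h2 := (lt_countP_iff hg (g Z[t] + 1) ht).mpr (Nat.lt_succ_self _)
      exact Nat.lt_succ_iff.mp ((lt_countP_iff hf _ ht).mp (h2.trans_le h1))
    have hb : ∀ x ∈ Z, Z.countP (f · < g x + 1) = Z.countP (g · < g x + 1) ∧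
        ∃ y ∈ Z, f y = g x := by
      intro x hx
      obtain ⟨b1, b2⟩ := h.block ⟨g x, gn x hx⟩ (cnt_map_ne_zero.mpr ⟨x, hx, rfl⟩)
      rw [psum_cnt f fn, psum_cnt g gn] at b1
      exact ⟨b1, cnt_map_ne_zero.mp b2⟩
    refine ⟨⟨h1, ?_⟩, fun x hx => ?_⟩
    · rw [List.pairwise_iff_getElem]
      intro s t hs ht _ hlt
      have h2 := (hb Z[s] (List.getElem_mem hs)).1
      have h3 := mt (lt_countP_iff hg (g Z[s] + 1) ht).mp (by omega)
      rw [← h2, lt_countP_iff hf _ ht] at h3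
      have h4 := h1 _ (List.getElem_mem hs)
      omega
    · obtain ⟨h2, y, hy, e⟩ := hb x hx
      obtain ⟨t, ht, rfl⟩ := List.getElem_of_mem hy
      have h3 := (lt_countP_iff hf (g x + 1) ht).mpr (by omega)
      rw [h2, lt_countP_iff hg _ ht] at h3
      have h4 := h1 _ hy
      exact ⟨_, hy, e, by omega⟩
  · rintro ⟨h, h3⟩
    have hs := (slideP_cnt_iff hf hg fn gn).mpr h
    obtain ⟨h1, h2⟩ := h
    refine ⟨hs.dom, hs.total, fun j hj => ?_⟩
    obtain ⟨x, hx, e⟩ := cnt_map_ne_zero.mp hj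
    obtain ⟨y, hy, e1, e2⟩ := h3 x hx
    refine ⟨?_, cnt_map_ne_zero.mpr ⟨y, hy, e1.trans e⟩⟩
    rw [psum_cnt f fn, psum_cnt g gn]
    refine List.countP_congr fun z hz => ?_
    simp only [decide_eq_true_eq]
    refine ⟨fun hzj => ?_, fun hzj => by have := h1 z hz; omega⟩
    obtain ⟨s, hs, rfl⟩ := List.getElem_of_mem hy
    obtain ⟨t, ht, rfl⟩ := List.getElem_of_mem hz
    by_contra hlt
    rcases lt_trichotomy s t with hst | rfl | hst
    · have := List.pairwise_iff_getElem.mp h2 s t hs ht hst (by omega)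
      omega
    · omega
    · have := hgm ht hs hst
      omega

end Positions

/-! ### Configurations: words whose letters carry positions -/

/-- The position of the letter `v` in the vector it comes from. -/
def idx (n v : ℕ) : ℕ := n - (v + 1) / 2

/-- The word `A` (for `r = 1`) or `B` (for `r = 0`). -/
def letterWord {n : ℕ} (r : ℕ) (a : Fin n → ℕ) : List ℕ :=
  (posWord a).map fun k => 2 * (n - k) - r

theorem wordA_eq {n : ℕ} (a : Fin n → ℕ) : wordA a = letterWord 1 a := by
  simp [wordA, letterWord, posWord, List.map_flatMap]

theorem wordB_eq {n : ℕ} (a : Fin n → ℕ) : wordB a = letterWord 0 a := by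
  simp [wordB, letterWord, posWord, List.map_flatMap]

theorem idx_antitone (n : ℕ) {v w : ℕ} (h : v ≤ w) : idx n w ≤ idx n v := by
  unfold idx; omega

theorem mem_letterWord {n r : ℕ} (hr : r ≤ 1) {a : Fin n → ℕ} {v : ℕ} (h : v ∈ letterWord r a) :
    idx n v < n ∧ v % 2 = r ∧ v = 2 * (n - idx n v) - r := by
  obtain ⟨k, hk, rfl⟩ := List.mem_map.mp h
  have := lt_of_mem_posWord hk
  unfold idx
  omega

theorem map_idx_letterWord {n r : ℕ} (hr : r ≤ 1) (a : Fin n → ℕ) :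
    (letterWord r a).map (idx n) = posWord a := by
  rw [letterWord, List.map_map]
  conv_rhs => rw [← List.map_id (posWord a)]
  refine List.map_congr_left fun k hk => ?_
  have := lt_of_mem_posWord hk
  simp only [Function.comp_apply, idx, id]
  omega

/-- The lexicographic order on pairs of a position and a letter. -/
def LexLE (x y : ℕ × ℕ) : Prop := x.1 < y.1 ∨ x.1 = y.1 ∧ x.2 ≤ y.2

theorem LexLE.antisymm {x y : ℕ × ℕ} (h1 : LexLE x y) (h2 : LexLE y x) : x = y := by
  unfold LexLE at h1 h2
  exact Prod.ext (by omega) (by omega)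

theorem LexLE.trans {x y z : ℕ × ℕ} (h1 : LexLE x y) (h2 : LexLE y z) : LexLE x z := by
  unfold LexLE at *
  omega

theorem LexLE.fst_le {x y : ℕ × ℕ} (h : LexLE x y) : x.1 ≤ y.1 := by
  unfold LexLE at h
  omega

section Part

variable {n r : ℕ} {a : Fin n → ℕ} {Z : List (ℕ × ℕ)}

theorem mem_letterWord_of_mem (hw : Z.map Prod.snd = letterWord r a) {x : ℕ × ℕ} (hx : x ∈ Z) :
    x.2 ∈ letterWord r a := by
  rw [← hw]
  exact List.mem_map_of_mem hx

theorem map_idx_snd (hr : r ≤ 1) (hw : Z.map Prod.snd = letterWord r a) :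
    Z.map (fun x => idx n x.2) = posWord a := by
  rw [← map_idx_letterWord hr a, ← hw, List.map_map]
  rfl

theorem pairwise_idx_snd (hr : r ≤ 1) (hw : Z.map Prod.snd = letterWord r a) :
    Z.Pairwise fun x y => idx n x.2 ≤ idx n y.2 := by
  have := pairwise_posWord a
  rwa [← map_idx_snd hr hw, List.pairwise_map] at this

/-- A letter of larger index is smaller, so the lexicographic order forbids it to follow at the same
position. -/
theorem pairwise_strict (n : ℕ) (hZ : Z.Pairwise LexLE) :
    Z.Pairwise fun x y => idx n x.2 < idx n y.2 → x.1 < y.1 := by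
  refine hZ.imp fun {x y} hxy hlt => ?_
  rcases hxy with h | ⟨-, h⟩
  · exact h
  · have := idx_antitone n h
    omega

theorem slideP_cnt_fst (hr : r ≤ 1) (hZ : Z.Pairwise LexLE) (hw : Z.map Prod.snd = letterWord r a)
    (fn : ∀ x ∈ Z, x.1 < n) :
    SlideP a (cnt n (Z.map Prod.fst)) ↔ ∀ x ∈ Z, x.1 ≤ idx n x.2 := by
  have h := slideP_cnt_iff (n := n) (hZ.imp LexLE.fst_le) (pairwise_idx_snd hr hw) fn
    fun x hx => (mem_letterWord hr (mem_letterWord_of_mem hw hx)).1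
  rw [map_idx_snd hr hw, cnt_posWord] at h
  rw [h]
  exact ⟨fun h => h.1, fun h => ⟨h, pairwise_strict n hZ⟩⟩

theorem atomP_cnt_fst (hr : r ≤ 1) (hZ : Z.Pairwise LexLE) (hw : Z.map Prod.snd = letterWord r a)
    (fn : ∀ x ∈ Z, x.1 < n) :
    AtomP a (cnt n (Z.map Prod.fst)) ↔
      (∀ x ∈ Z, x.1 ≤ idx n x.2) ∧ ∀ x ∈ Z, (idx n x.2, x.2) ∈ Z := by
  have hm := fun x (hx : x ∈ Z) => mem_letterWord hr (mem_letterWord_of_mem hw hx)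
  have h := atomP_cnt_iff (n := n) (hZ.imp LexLE.fst_le) (pairwise_idx_snd hr hw) fn
    fun x hx => (hm x hx).1
  rw [map_idx_snd hr hw, cnt_posWord] at h
  rw [h]
  constructor
  · rintro ⟨h1, h2⟩
    refine ⟨h1.1, fun x hx => ?_⟩
    obtain ⟨⟨p, v⟩, hy, e1, e2⟩ := h2 x hx
    have h3 := (hm _ hy).2.2
    rw [e2, ← (hm x hx).2.2] at h3
    simp only at e1 h3
    rwa [e1, h3] at hy
  · rintro ⟨h1, h2⟩
    exact ⟨⟨h1, pairwise_strict n hZ⟩, fun x hx => ⟨_, h2 x hx, rfl, rfl⟩⟩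

/-- The letters of a word with the positions prescribed by `g`. -/
def place (r : ℕ) (a g : Fin n → ℕ) : List (ℕ × ℕ) := (posWord g).zip (letterWord r a)

theorem length_posWord (g : Fin n → ℕ) : (posWord g).length = psum g n := by
  rw [posWord, List.length_flatMap, psum_self, Fin.sum_univ_def]
  simp

theorem map_fst_place {g : Fin n → ℕ} (h : SlideP a g) :
    (place r a g).map Prod.fst = posWord g := by
  refine List.map_fst_zip ?_
  rw [letterWord, List.length_map, length_posWord, length_posWord, h.total]

theorem map_snd_place {g : Fin n → ℕ} (h : SlideP a g) :
    (place r a g).map Prod.snd = letterWord r a := by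
  refine List.map_snd_zip ?_
  rw [letterWord, List.length_map, length_posWord, length_posWord, h.total]

theorem fst_lt_of_mem_place {g : Fin n → ℕ} {x : ℕ × ℕ} (h : x ∈ place r a g) : x.1 < n :=
  lt_of_mem_posWord (List.of_mem_zip h).1

theorem pairwise_place (hr : r ≤ 1) {g : Fin n → ℕ} (h : SlideP a g) :
    (place r a g).Pairwise LexLE := by
  have hw := map_snd_place (r := r) h
  have hf : (place r a g).Pairwise fun x y => x.1 ≤ y.1 := by
    have := pairwise_posWord g
    rwa [← map_fst_place (r := r) h, List.pairwise_map] at this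
  have hg := pairwise_idx_snd hr hw
  have hm := fun x (hx : x ∈ place r a g) => mem_letterWord hr (mem_letterWord_of_mem hw hx)
  have h' := h
  rw [← cnt_posWord a, ← cnt_posWord g, ← map_fst_place (r := r) h, ← map_idx_snd hr hw,
    slideP_cnt_iff hf hg (fun x => fst_lt_of_mem_place) fun x hx => (hm x hx).1] at h'
  refine ((hf.and hg).and h'.2).imp_of_mem ?_
  rintro x y hx hy ⟨⟨h1, h2⟩, h3⟩
  have h4 := (hm x hx).2.2
  have h5 := (hm y hy).2.2
  unfold LexLE
  by_cases e : x.1 = y.1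
  · have : idx n x.2 = idx n y.2 := by omega
    rw [this] at h4
    exact Or.inr ⟨e, by omega⟩
  · exact Or.inl (by omega)

end Part

/-- The letters of a given parity. -/
def part (r : ℕ) (L : List (ℕ × ℕ)) : List (ℕ × ℕ) := L.filter fun x => x.2 % 2 = r

theorem mem_part {r : ℕ} {L : List (ℕ × ℕ)} {x : ℕ × ℕ} : x ∈ part r L ↔ x ∈ L ∧ x.2 % 2 = r := by
  simp [part]

/-- A common refinement of the two sides of the product formula: the letters of `A` and `B` with
positions, sorted lexicographically, such that the positions of the letters of `A` describe a
monomial of the slide polynomial of `a`, and those of `B` a monomial of the atom of `b`. -/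
structure IsConf {n : ℕ} (a b : Fin n → ℕ) (L : List (ℕ × ℕ)) : Prop where
  sorted : L.Pairwise LexLE
  odd : (part 1 L).map Prod.snd = letterWord 1 a
  even : (part 0 L).map Prod.snd = letterWord 0 b
  bound : ∀ x ∈ L, x.1 ≤ idx n x.2
  anchor : ∀ x ∈ L, x.2 % 2 = 0 → (idx n x.2, x.2) ∈ L

theorem IsConf.idx_lt {n : ℕ} {a b : Fin n → ℕ} {L : List (ℕ × ℕ)} (h : IsConf a b L)
    {x : ℕ × ℕ} (hx : x ∈ L) : idx n x.2 < n := by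
  rcases Nat.mod_two_eq_zero_or_one x.2 with hp | hp
  · exact (mem_letterWord zero_le_one
      (mem_letterWord_of_mem h.even (mem_part.mpr ⟨hx, hp⟩))).1
  · exact (mem_letterWord le_rfl
      (mem_letterWord_of_mem h.odd (mem_part.mpr ⟨hx, hp⟩))).1

theorem IsConf.fst_lt {n : ℕ} {a b : Fin n → ℕ} {L : List (ℕ × ℕ)} (h : IsConf a b L)
    {x : ℕ × ℕ} (hx : x ∈ L) : x.1 < n := (h.bound x hx).trans_lt (h.idx_lt hx)

theorem pairwise_part {r : ℕ} {L : List (ℕ × ℕ)} (h : L.Pairwise LexLE) :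
    (part r L).Pairwise LexLE := h.filter _

/-- The exponents of the two factors can be read off a sorted word with positions. -/
theorem isConf_iff {n : ℕ} {a b : Fin n → ℕ} {L : List (ℕ × ℕ)} (h : L.Pairwise LexLE)
    (odd : (part 1 L).map Prod.snd = letterWord 1 a)
    (even : (part 0 L).map Prod.snd = letterWord 0 b) (fn : ∀ x ∈ L, x.1 < n) :
    IsConf a b L ↔ SlideP a (cnt n ((part 1 L).map Prod.fst)) ∧
      AtomP b (cnt n ((part 0 L).map Prod.fst)) := by
  rw [slideP_cnt_fst le_rfl (pairwise_part h) odd fun x hx => fn x (mem_part.mp hx).1,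
    atomP_cnt_fst zero_le_one (pairwise_part h) even fun x hx => fn x (mem_part.mp hx).1]
  constructor
  · intro h
    exact ⟨fun x hx => h.bound x (mem_part.mp hx).1, fun x hx => h.bound x (mem_part.mp hx).1,
      fun x hx => mem_part.mpr ⟨h.anchor x (mem_part.mp hx).1 (mem_part.mp hx).2,
        (mem_part.mp hx).2⟩⟩
  · rintro ⟨h1, h2, h3⟩
    refine ⟨h, odd, even, fun x hx => ?_, fun x hx hp => (mem_part.mp (h3 x
      (mem_part.mpr ⟨hx, hp⟩))).1⟩
    rcases Nat.mod_two_eq_zero_or_one x.2 with hp | hp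
    · exact h2 x (mem_part.mpr ⟨hx, hp⟩)
    · exact h1 x (mem_part.mpr ⟨hx, hp⟩)

open Classical in
/-- Sorting into lexicographic order. -/
def lexSort (L : List (ℕ × ℕ)) : List (ℕ × ℕ) := L.mergeSort fun x y => LexLE x y

theorem lexSort_perm (L : List (ℕ × ℕ)) : (lexSort L).Perm L := List.mergeSort_perm _ _

theorem pairwise_lexSort (L : List (ℕ × ℕ)) : (lexSort L).Pairwise LexLE := by
  classical
  have h := List.pairwise_mergeSort (le := fun x y => decide (LexLE x y))
    (fun x y z h1 h2 => by
      simp only [decide_eq_true_eq] at h1 h2 ⊢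
      exact h1.trans h2)
    (fun x y => by
      rw [Bool.or_eq_true, decide_eq_true_eq, decide_eq_true_eq, LexLE, LexLE]
      omega) L
  have e : lexSort L = L.mergeSort fun x y => decide (LexLE x y) := by
    unfold lexSort
    congr!
  rw [e]
  simpa using h

theorem eq_of_perm_of_lex {L L' : List (ℕ × ℕ)} (h : L.Perm L') (h1 : L.Pairwise LexLE)
    (h2 : L'.Pairwise LexLE) : L = L' :=
  List.Perm.eq_of_pairwise (fun _ _ _ _ => LexLE.antisymm) h1 h2 h

/-- The configuration of a pair of exponents. -/
def merge {n : ℕ} (a b : Fin n → ℕ) (x : (Fin n → ℕ) × (Fin n → ℕ)) : List (ℕ × ℕ) :=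
  lexSort (place 1 a x.1 ++ place 0 b x.2)

theorem merge_perm {n : ℕ} (a b c d : Fin n → ℕ) :
    (merge a b (c, d)).Perm (place 1 a c ++ place 0 b d) := lexSort_perm _

theorem pairwise_merge {n : ℕ} (a b : Fin n → ℕ) (x : (Fin n → ℕ) × (Fin n → ℕ)) :
    (merge a b x).Pairwise LexLE := pairwise_lexSort _

theorem part_self {n r : ℕ} (hr : r ≤ 1) {a : Fin n → ℕ} {Z : List (ℕ × ℕ)}
    (hw : Z.map Prod.snd = letterWord r a) : part r Z = Z := by
  rw [part, List.filter_eq_self]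
  intro x hx
  simpa using (mem_letterWord hr (mem_letterWord_of_mem hw hx)).2.1

theorem part_other {n r s : ℕ} (hr : r ≤ 1) (hrs : r ≠ s) {a : Fin n → ℕ} {Z : List (ℕ × ℕ)}
    (hw : Z.map Prod.snd = letterWord r a) : part s Z = [] := by
  rw [part, List.filter_eq_nil_iff]
  intro x hx
  simpa [(mem_letterWord hr (mem_letterWord_of_mem hw hx)).2.1] using hrs

section Merge

variable {n : ℕ} {a b c d : Fin n → ℕ}

theorem part_one_merge (h1 : SlideP a c) (h2 : SlideP b d) :
    part 1 (merge a b (c, d)) = place 1 a c := by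
  refine eq_of_perm_of_lex (((merge_perm a b c d).filter _).trans (List.Perm.of_eq ?_))
    (pairwise_part (pairwise_merge _ _ _)) (pairwise_place le_rfl h1)
  rw [List.filter_append]
  change part 1 _ ++ part 1 _ = _
  rw [part_self le_rfl (map_snd_place h1), part_other zero_le_one zero_ne_one (map_snd_place h2),
    List.append_nil]

theorem part_zero_merge (h1 : SlideP a c) (h2 : SlideP b d) :
    part 0 (merge a b (c, d)) = place 0 b d := by
  refine eq_of_perm_of_lex (((merge_perm a b c d).filter _).trans (List.Perm.of_eq ?_))
    (pairwise_part (pairwise_merge _ _ _)) (pairwise_place zero_le_one h2)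
  rw [List.filter_append]
  change part 0 _ ++ part 0 _ = _
  rw [part_self zero_le_one (map_snd_place h2), part_other le_rfl one_ne_zero (map_snd_place h1),
    List.nil_append]

/-- On words of positions the atom condition is the slide condition together with anchors. -/
theorem AtomP.slideP (h : AtomP a c) : SlideP a c := by
  have fn : ∀ x ∈ (posWord c).zip (posWord a), x.1 < n :=
    fun x hx => lt_of_mem_posWord (List.of_mem_zip hx).1
  have gn : ∀ x ∈ (posWord c).zip (posWord a), x.2 < n :=
    fun x hx => lt_of_mem_posWord (List.of_mem_zip hx).2
  have e1 : ((posWord c).zip (posWord a)).map Prod.fst = posWord c :=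
    List.map_fst_zip (by rw [length_posWord, length_posWord, h.total])
  have e2 : ((posWord c).zip (posWord a)).map Prod.snd = posWord a :=
    List.map_snd_zip (by rw [length_posWord, length_posWord, h.total])
  have hf := pairwise_posWord c
  rw [← e1, List.pairwise_map] at hf
  have hg := pairwise_posWord a
  rw [← e2, List.pairwise_map] at hg
  have h1 := atomP_cnt_iff hf hg fn gn
  have h2 := slideP_cnt_iff hf hg fn gn
  rw [e1, e2, cnt_posWord, cnt_posWord] at h1 h2
  exact h2.mpr (h1.mp h).1

theorem isConf_merge (h1 : SlideP a c) (h2 : AtomP b d) : IsConf a b (merge a b (c, d)) := by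
  have e1 := part_one_merge h1 h2.slideP
  have e2 := part_zero_merge h1 h2.slideP
  refine (isConf_iff (pairwise_merge _ _ _) ?_ ?_ ?_).mpr ⟨?_, ?_⟩
  · rw [e1, map_snd_place h1]
  · rw [e2, map_snd_place h2.slideP]
  · intro x hx
    rcases List.mem_append.mp ((merge_perm a b c d).mem_iff.mp hx) with h | h <;>
      exact fst_lt_of_mem_place h
  · rw [e1, map_fst_place h1, cnt_posWord]
    exact h1
  · rw [e2, map_fst_place h2.slideP, cnt_posWord]
    exact h2

theorem cnt_append (P Q : List ℕ) : cnt n (P ++ Q) = cnt n P + cnt n Q := by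
  funext i
  simp [cnt]

theorem cnt_perm {P Q : List ℕ} (h : P.Perm Q) : cnt n P = cnt n Q := by
  funext i
  exact h.count_eq _

theorem cnt_merge (h1 : SlideP a c) (h2 : SlideP b d) :
    cnt n ((merge a b (c, d)).map Prod.fst) = c + d := by
  rw [cnt_perm ((merge_perm a b c d).map _), List.map_append, cnt_append, map_fst_place h1,
    map_fst_place h2, cnt_posWord, cnt_posWord]

/-- Within one parity both the letters and the positions come in a known order, so multiplicities
determine the part; sorting then determines `L`. -/
theorem IsConf.eq_merge {L : List (ℕ × ℕ)} (h : IsConf a b L) :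
    merge a b (cnt n ((part 1 L).map Prod.fst), cnt n ((part 0 L).map Prod.fst)) = L := by
  refine eq_of_perm_of_lex ((merge_perm _ _ _ _).trans ?_) (pairwise_merge _ _ _) h.sorted
  have hp : ∀ r, ∀ e : Fin n → ℕ, (part r L).map Prod.snd = letterWord r e →
      place r e (cnt n ((part r L).map Prod.fst)) = part r L := by
    intro r e he
    rw [place, posWord_cnt, ← he, ← List.unzip_fst, ← List.unzip_snd, List.zip_unzip]
    · exact List.pairwise_map.mpr ((pairwise_part h.sorted).imp LexLE.fst_le)
    · intro k hk
      obtain ⟨x, hx, rfl⟩ := List.mem_map.mp hk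
      exact h.fst_lt (mem_part.mp hx).1
  rw [hp 1 a h.odd, hp 0 b h.even]
  have e : part 0 L = L.filter fun x => !decide (x.2 % 2 = 1) := by
    refine List.filter_congr fun x _ => ?_
    rcases Nat.mod_two_eq_zero_or_one x.2 with hp | hp <;> simp [hp]
  rw [e]
  exact List.filter_append_perm _ _

/-- The finite set of all configurations. -/
def confSet (a b : Fin n → ℕ) : Finset (List (ℕ × ℕ)) :=
  (monoSet (∑ j, a j) (SlideP a) ×ˢ monoSet (∑ j, b j) (AtomP b)).image (merge a b)

theorem mem_confSet {L : List (ℕ × ℕ)} : L ∈ confSet a b ↔ IsConf a b L := by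
  simp only [confSet, Finset.mem_image, Finset.mem_product, mem_monoSet]
  constructor
  · rintro ⟨⟨c, d⟩, ⟨⟨-, h1⟩, -, h2⟩, rfl⟩
    exact isConf_merge h1 h2
  · intro h
    obtain ⟨h1, h2⟩ := (isConf_iff h.sorted h.odd h.even fun x => h.fst_lt).mp h
    refine ⟨_, ⟨⟨?_, h1⟩, ?_, h2⟩, h.eq_merge⟩
    · rw [← psum_self, ← psum_self, h1.total]
    · rw [← psum_self, ← psum_self, h2.total]

theorem slide_mul_atom_eq (a b : Fin n → ℕ) : fundamentalSlide a * fundamentalAtom b =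
    ∑ L ∈ confSet a b, xpow (cnt n (L.map Prod.fst)) := by
  rw [fundamentalSlide_eq, fundamentalAtom_eq, monoSum, monoSum, Finset.sum_mul_sum,
    ← Finset.sum_product', confSet, Finset.sum_image]
  · refine Finset.sum_congr rfl fun x hx => ?_
    obtain ⟨c, d⟩ := x
    simp only [Finset.mem_product, mem_monoSet] at hx
    rw [cnt_merge hx.1.2 hx.2.2.slideP, xpow_add]
  · rintro ⟨c, d⟩ hx ⟨c', d'⟩ hy e
    simp only [Finset.coe_product, Set.mem_prod, Finset.mem_coe, mem_monoSet] at hx hy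
    have e1 : cnt n ((part 1 (merge a b (c, d))).map Prod.fst) =
        cnt n ((part 1 (merge a b (c', d'))).map Prod.fst) := by rw [e]
    have e2 : cnt n ((part 0 (merge a b (c, d))).map Prod.fst) =
        cnt n ((part 0 (merge a b (c', d'))).map Prod.fst) := by rw [e]
    rw [part_one_merge hx.1.2 hx.2.2.slideP, part_one_merge hy.1.2 hy.2.2.slideP,
      map_fst_place hx.1.2, map_fst_place hy.1.2, cnt_posWord, cnt_posWord] at e1
    rw [part_zero_merge hx.1.2 hx.2.2.slideP, part_zero_merge hy.1.2 hy.2.2.slideP,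
      map_fst_place hx.2.2.slideP, map_fst_place hy.2.2.slideP, cnt_posWord, cnt_posWord] at e2
    rw [e1, e2]

end Merge

/-! ### Moving the letters of each run to the position of its last letter -/

/-- Move each letter of a word with positions to the position of the last letter of its run. -/
def settle : List (ℕ × ℕ) → List (ℕ × ℕ)
  | [] => []
  | (p, v) :: L => match settle L with
    | [] => [(p, v)]
    | (q, w) :: L' => (if v ≤ w then q else p, v) :: (q, w) :: L'

/-- Neighbouring letters have the same position at ascents and increasing positions at
descents. -/
def Settled (L : List (ℕ × ℕ)) : Prop :=
  L.IsChain fun x y => (x.2 ≤ y.2 → x.1 = y.1) ∧ (y.2 < x.2 → x.1 < y.1)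

theorem Settled.pairwise {L : List (ℕ × ℕ)} (h : Settled L) : L.Pairwise LexLE := by
  have : IsTrans (ℕ × ℕ) LexLE := ⟨fun _ _ _ => LexLE.trans⟩
  rw [← List.isChain_iff_pairwise]
  refine h.imp fun x y hxy => ?_
  unfold LexLE
  omega

/-- A list of triples `(p, q, v)` of two positions and a letter such that the positions `p` are
obtained from the positions `q` as in the exponents of an atom. -/
structure Spread (Z : List (ℕ × ℕ × ℕ)) : Prop where
  fst : Z.Pairwise fun x y => x.1 ≤ y.1
  snd : Z.Pairwise fun x y => x.2.1 ≤ y.2.1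
  le : ∀ x ∈ Z, x.1 ≤ x.2.1
  strict : Z.Pairwise fun x y => x.2.1 < y.2.1 → x.1 < y.1
  anchor : ∀ x ∈ Z, ∃ y ∈ Z, y.1 = x.2.1 ∧ y.2.1 = x.2.1

theorem Spread.atomP_iff {n : ℕ} {Z : List (ℕ × ℕ × ℕ)} (h1 : Z.Pairwise fun x y => x.1 ≤ y.1)
    (h2 : Z.Pairwise fun x y => x.2.1 ≤ y.2.1) (fn : ∀ x ∈ Z, x.1 < n)
    (gn : ∀ x ∈ Z, x.2.1 < n) :
    AtomP (cnt n (Z.map fun z => z.2.1)) (cnt n (Z.map fun z => z.1)) ↔ Spread Z := by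
  rw [atomP_cnt_iff h1 h2 fn gn]
  exact ⟨fun h => ⟨h1, h2, h.1.1, h.1.2, h.2⟩, fun h => ⟨⟨h.le, h.strict⟩, h.anchor⟩⟩

/-- `Z` records the old and the new position of each letter. Bounds survive because a letter joins
the run of `w` only if `v ≤ w`, and then `idx n w ≤ idx n v`. -/
theorem settle_spec (n : ℕ) (L : List (ℕ × ℕ)) (h : L.Pairwise LexLE) :
    Settled (settle L) ∧ ∃ Z : List (ℕ × ℕ × ℕ), Z.map (fun z => (z.1, z.2.2)) = L ∧
      Z.map Prod.snd = settle L ∧ Spread Z ∧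
      ((∀ x ∈ L, x.1 ≤ idx n x.2) → ∀ z ∈ Z, z.2.1 ≤ idx n z.2.2) := by
  induction L with
  | nil =>
    exact ⟨List.IsChain.nil, [], rfl, rfl, ⟨by simp, by simp, by simp, by simp, by simp⟩, by simp⟩
  | cons x L ih =>
    obtain ⟨p, v⟩ := x
    rw [List.pairwise_cons] at h
    obtain ⟨h1, Z, h2, h3, h4, h5⟩ := ih h.2
    rcases Z with _ | ⟨⟨p1, q1, w⟩, Z⟩
    · obtain rfl : [] = L := h2
      refine ⟨List.IsChain.singleton _, [(p, p, v)], rfl, rfl, ?_, by simp⟩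
      exact ⟨by simp, by simp, by simp, by simp, by simp⟩
    · obtain rfl := h2
      have e : settle ((p, v) :: ((p1, q1, w) :: Z).map fun z => (z.1, z.2.2)) =
          (if v ≤ w then q1 else p, v) :: (q1, w) :: Z.map Prod.snd := by
        rw [settle, ← h3]
        rfl
      rw [e]
      rw [← h3, List.map_cons] at h1
      have hp : ∀ y ∈ (p1, q1, w) :: Z, LexLE (p, v) (y.1, y.2.2) := fun y hy =>
        h.1 _ (List.mem_map_of_mem hy)
      have hp1 := hp _ List.mem_cons_self
      have hq1 := h4.le _ List.mem_cons_self
      have hf := List.pairwise_cons.mp h4.fst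
      have hg := List.pairwise_cons.mp h4.snd
      have hs := List.pairwise_cons.mp h4.strict
      simp only [LexLE] at hp1 hq1
      refine ⟨List.IsChain.cons_cons ?_ h1,
        (p, if v ≤ w then q1 else p, v) :: (p1, q1, w) :: Z, by simp, by simp, ?_, ?_⟩
      · simp only
        split_ifs <;> omega
      · refine ⟨List.pairwise_cons.mpr ⟨fun y hy => (hp y hy).fst_le, h4.fst⟩,
          List.pairwise_cons.mpr ⟨?_, h4.snd⟩, ?_, List.pairwise_cons.mpr ⟨?_, h4.strict⟩, ?_⟩
        · intro y hy
          have e1 := (hp y hy).fst_le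
          have e2 := h4.le y hy
          simp only at e1 ⊢
          split_ifs
          · rcases List.mem_cons.mp hy with rfl | hy
            · exact le_rfl
            · exact hg.1 y hy
          · omega
        · intro y hy
          rcases List.mem_cons.mp hy with rfl | hy
          · simp only
            split_ifs <;> omega
          · exact h4.le y hy
        · intro y hy
          simp only
          rcases List.mem_cons.mp hy with rfl | hy
          · simp only
            split_ifs <;> omega
          · have e1 := hf.1 y hy
            have e2 := hs.1 y hy
            simp only at e1 e2
            split_ifs <;> omega
        · intro x hx
          rcases List.mem_cons.mp hx with rfl | hx
          -- A letter joining the next run inherits its anchor; a letter before a descent stays and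
          -- is its own anchor.
          · by_cases hvw : v ≤ w
            · obtain ⟨y, hy, hy'⟩ := h4.anchor _ List.mem_cons_self
              exact ⟨y, List.mem_cons_of_mem _ hy, by simpa [hvw] using hy'⟩
            · exact ⟨_, List.mem_cons_self, by simp [hvw], rfl⟩
          · obtain ⟨y, hy, hy'⟩ := h4.anchor _ hx
            exact ⟨y, List.mem_cons_of_mem _ hy, hy'⟩
      · intro hb z hz
        have h5 := h5 fun x hx => hb x (List.mem_cons_of_mem _ hx)
        rcases List.mem_cons.mp hz with rfl | hz
        · have e1 := hb (p, v) List.mem_cons_self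
          have e2 := h5 _ List.mem_cons_self
          simp only at e1 e2 ⊢
          split_ifs with hvw
          · exact e2.trans (idx_antitone n hvw)
          · exact e1
        · exact h5 z hz

/-- In a settled word the letters sharing a position `q` form one run. Its anchor and `p ≤ q` force
the last letter to have `p = q`, so settling restores `q` on the whole run. -/
theorem settle_eq_of_spread (Z : List (ℕ × ℕ × ℕ)) (h : Spread Z) (hs : Settled (Z.map Prod.snd)) :
    settle (Z.map fun z => (z.1, z.2.2)) = Z.map Prod.snd := by
  induction Z with
  | nil => rfl
  | cons z Z ih =>
    obtain ⟨p, q, v⟩ := z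
    have hf := List.pairwise_cons.mp h.fst
    have hg := List.pairwise_cons.mp h.snd
    have hst := List.pairwise_cons.mp h.strict
    have hpq := h.le _ List.mem_cons_self
    simp only at hpq
    have hZ : Spread Z := by
      refine ⟨hf.2, hg.2, fun x hx => h.le x (List.mem_cons_of_mem _ hx), hst.2, fun x hx => ?_⟩
      obtain ⟨y, hy, e1, e2⟩ := h.anchor x (List.mem_cons_of_mem _ hx)
      rcases List.mem_cons.mp hy with rfl | hy
      -- If the removed first letter was the anchor of `x`, then `x` is squeezed onto the same
      -- position and is its own anchor.
      · have e3 := hf.1 x hx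
        have e4 := h.le x (List.mem_cons_of_mem _ hx)
        simp only at e1 e2 e3
        exact ⟨x, hx, by omega, rfl⟩
      · exact ⟨y, hy, e1, e2⟩
    have ih := ih hZ (List.IsChain.tail hs)
    obtain ⟨y, hy, e1, e2⟩ := h.anchor _ List.mem_cons_self
    simp only at e1 e2
    rcases Z with _ | ⟨⟨p1, q1, w⟩, Z⟩
    · rw [List.mem_singleton] at hy
      subst hy
      simp only at e1
      subst e1
      rfl
    · have hc := (List.isChain_cons_cons.mp hs).1
      simp only at hc
      rw [List.map_cons, settle, ih]
      simp only [List.map_cons]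
      congr 2
      split_ifs with hvw
      · exact (hc.1 hvw).symm
      · rcases List.mem_cons.mp hy with rfl | hy
        · exact e1
        -- After a descent all later letters have larger `q`, so none of them can be the anchor.
        · have hq := hc.2 (by omega)
          rcases List.mem_cons.mp hy with rfl | hy
          · simp only at e2
            omega
          · have := (List.pairwise_cons.mp hg.2).1 y hy
            simp only at this
            omega

theorem map_snd_part (r : ℕ) (L : List (ℕ × ℕ)) :
    (part r L).map Prod.snd = (L.map Prod.snd).filter fun v => v % 2 = r := by
  rw [part, List.filter_map]
  rfl

section Conf

variable {n : ℕ} {a b : Fin n → ℕ}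

theorem map_snd_settle {L : List (ℕ × ℕ)} (h : L.Pairwise LexLE) :
    (settle L).map Prod.snd = L.map Prod.snd := by
  obtain ⟨-, Z, h1, h2, -⟩ := settle_spec 0 L h
  rw [← h2, ← h1, List.map_map, List.map_map]
  rfl

theorem IsConf.letter_eq {L : List (ℕ × ℕ)} (h : IsConf a b L) {x : ℕ × ℕ} (hx : x ∈ L) :
    x.2 = 2 * (n - idx n x.2) - x.2 % 2 := by
  rcases Nat.mod_two_eq_zero_or_one x.2 with hp | hp <;> rw [hp]
  · exact (mem_letterWord zero_le_one
      (mem_letterWord_of_mem h.even (mem_part.mpr ⟨hx, hp⟩))).2.2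
  · exact (mem_letterWord le_rfl
      (mem_letterWord_of_mem h.odd (mem_part.mpr ⟨hx, hp⟩))).2.2

/-- A letter at its own index is already as far right as its bound permits, and settling moves
letters only to the right, so it stays. -/
theorem IsConf.settle {L : List (ℕ × ℕ)} (h : IsConf a b L) : IsConf a b (settle L) := by
  obtain ⟨h1, Z, h2, h3, h4, h5⟩ := settle_spec n L h.sorted
  have h5 := h5 h.bound
  have hsnd := map_snd_settle h.sorted
  refine ⟨h1.pairwise, ?_, ?_, ?_, ?_⟩
  · rw [map_snd_part, hsnd, ← map_snd_part, h.odd]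
  · rw [map_snd_part, hsnd, ← map_snd_part, h.even]
  · rw [← h3]
    intro x hx
    obtain ⟨z, hz, rfl⟩ := List.mem_map.mp hx
    exact h5 z hz
  · rw [← h3]
    intro x hx hp
    obtain ⟨z, hz, rfl⟩ := List.mem_map.mp hx
    have hm : (z.1, z.2.2) ∈ L := by
      rw [← h2]
      exact List.mem_map_of_mem (f := fun z : ℕ × ℕ × ℕ => (z.1, z.2.2)) hz
    have hz' := h.anchor _ hm hp
    rw [← h2] at hz'
    obtain ⟨z', hz', e⟩ := List.mem_map.mp hz'
    rw [Prod.mk.injEq] at e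
    have e1 := h4.le _ hz'
    have e2 := h5 _ hz'
    refine List.mem_map.mpr ⟨z', hz', Prod.ext ?_ e.2⟩
    rw [e.2] at e2
    simp only at e e2 ⊢
    omega

theorem isConf_of_spread {Z : List (ℕ × ℕ × ℕ)} (h : Spread Z)
    (hc : IsConf a b (Z.map Prod.snd)) : IsConf a b (Z.map fun z => (z.1, z.2.2)) := by
  have hsnd : (Z.map fun z => (z.1, z.2.2)).map Prod.snd = (Z.map Prod.snd).map Prod.snd := by
    rw [List.map_map, List.map_map]
    rfl
  refine ⟨?_, ?_, ?_, ?_, ?_⟩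
  · rw [List.pairwise_map]
    have := hc.sorted
    rw [List.pairwise_map] at this
    refine ((this.and h.fst).and h.strict).imp ?_
    rintro x y ⟨⟨e1, e2⟩, e3⟩
    unfold LexLE at *
    simp only
    omega
  · rw [map_snd_part, hsnd, ← map_snd_part, hc.odd]
  · rw [map_snd_part, hsnd, ← map_snd_part, hc.even]
  · intro x hx
    obtain ⟨z, hz, rfl⟩ := List.mem_map.mp hx
    exact (h.le z hz).trans (hc.bound _ (List.mem_map_of_mem hz))
  · intro x hx hp
    obtain ⟨z0, hz0, rfl⟩ := List.mem_map.mp hx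
    simp only at hp ⊢
    obtain ⟨z, hz, e⟩ := List.mem_map.mp (hc.anchor _ (List.mem_map_of_mem hz0) hp)
    obtain ⟨y, hy, e1, e2⟩ := h.anchor z hz
    have hlt := hc.idx_lt (List.mem_map_of_mem (f := Prod.snd) hz0)
    have hzq : z.2.1 = idx n z0.2.2 := by rw [e]
    have hzv : z.2.2 = z0.2.2 := by rw [e]
    obtain ⟨s, hs, rfl⟩ := List.getElem_of_mem hz
    obtain ⟨t, ht, rfl⟩ := List.getElem_of_mem hy
    rcases Nat.lt_or_ge s t with hst | hst
    -- The anchor `Z[t]` follows `Z[s]` at the same settled position, so its letter is at least as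
    -- large, while its bound makes the index no smaller. The even letter is the larger of the two
    -- with this index, so both letters agree.
    · have e3 := hc.bound _ (List.mem_map_of_mem hy)
      have e4 := List.pairwise_iff_getElem.mp (List.pairwise_map.mp hc.sorted) s t hs ht hst
      unfold LexLE at e4
      have e5 : Z[s].2.2 ≤ Z[t].2.2 := by omega
      refine List.mem_map.mpr ⟨Z[t], hy, Prod.ext (by simp only; omega) ?_⟩
      have e6 := hc.letter_eq (List.mem_map_of_mem (f := Prod.snd) hz0)
      have e7 := hc.letter_eq (List.mem_map_of_mem (f := Prod.snd) hy)
      simp only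
      omega
    -- Here the anchor does not come after `Z[s]`, so `Z[s]` is squeezed onto its index.
    · refine List.mem_map.mpr ⟨Z[s], hz, Prod.ext ?_ hzv⟩
      have e3 := h.le _ hz
      have e4 : Z[t].1 ≤ Z[s].1 := by
        rcases hst.lt_or_eq with hst | rfl
        · exact List.pairwise_iff_getElem.mp h.fst t s ht hs hst
        · exact le_rfl
      simp only
      omega

theorem eq_of_map_eq {L L' : List (ℕ × ℕ)} (h1 : L.map Prod.fst = L'.map Prod.fst)
    (h2 : L.map Prod.snd = L'.map Prod.snd) : L = L' := by
  rw [← List.zip_unzip L, ← List.zip_unzip L', List.unzip_fst, List.unzip_snd, List.unzip_fst,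
    List.unzip_snd, h1, h2]

theorem IsConf.posWord_cnt {L : List (ℕ × ℕ)} (h : IsConf a b L) :
    posWord (cnt n (L.map Prod.fst)) = L.map Prod.fst := by
  refine FundAtom.posWord_cnt (List.pairwise_map.mpr (h.sorted.imp LexLE.fst_le)) fun k hk => ?_
  obtain ⟨x, hx, rfl⟩ := List.mem_map.mp hk
  exact h.fst_lt hx

/-- The letters are fixed in a fibre, so positions determine its elements. They form atom exponents
by `settle_spec`, and all of them occur by `settle_eq_of_spread` and `isConf_of_spread`. -/
theorem fundamentalAtom_settled {L' : List (ℕ × ℕ)} (hc : IsConf a b L') (hs : Settled L') :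
    ∑ L ∈ (confSet a b).filter (fun L => settle L = L'), xpow (cnt n (L.map Prod.fst)) =
      fundamentalAtom (cnt n (L'.map Prod.fst)) := by
  rw [fundamentalAtom_eq, monoSum]
  refine Finset.sum_bij (fun L _ => cnt n (L.map Prod.fst)) ?_ ?_ ?_ fun _ _ => rfl
  · intro L hL
    rw [Finset.mem_filter, mem_confSet] at hL
    obtain ⟨hL, rfl⟩ := hL
    obtain ⟨-, Z, h2, h3, h4, -⟩ := settle_spec n L hL.sorted
    have h5 : AtomP (cnt n ((settle L).map Prod.fst)) (cnt n (L.map Prod.fst)) := by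
      rw [← h3, ← h2, List.map_map, List.map_map]
      refine (Spread.atomP_iff h4.fst h4.snd ?_ ?_).mpr h4
      · intro z hz
        exact hL.fst_lt (x := (z.1, z.2.2)) (by
          rw [← h2]
          exact List.mem_map_of_mem (f := fun z : ℕ × ℕ × ℕ => (z.1, z.2.2)) hz)
      · intro z hz
        exact hc.fst_lt (x := z.2) (by
          rw [← h3]
          exact List.mem_map_of_mem hz)
    rw [mem_monoSet]
    exact ⟨by rw [← psum_self, ← psum_self, h5.total], h5⟩
  · intro L1 h1 L2 h2 e
    rw [Finset.mem_filter, mem_confSet] at h1 h2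
    refine eq_of_map_eq ?_ ?_
    · rw [← h1.1.posWord_cnt, ← h2.1.posWord_cnt, e]
    · rw [← map_snd_settle h1.1.sorted, ← map_snd_settle h2.1.sorted, h1.2, h2.2]
  · intro g hg
    rw [mem_monoSet] at hg
    have hlen : (posWord g).length = L'.length := by
      rw [length_posWord, hg.2.total, ← length_posWord, hc.posWord_cnt, List.length_map]
    have m1 : ((posWord g).zip L').map Prod.fst = posWord g := List.map_fst_zip hlen.le
    have m2 : ((posWord g).zip L').map Prod.snd = L' := List.map_snd_zip hlen.ge
    have hg' := hg.2
    have h1 : ((posWord g).zip L').Pairwise fun x y => x.1 ≤ y.1 := by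
      have := pairwise_posWord g
      rwa [← m1, List.pairwise_map] at this
    have h2 : ((posWord g).zip L').Pairwise fun x y => x.2.1 ≤ y.2.1 := by
      have := hc.sorted.imp LexLE.fst_le
      rwa [← m2, List.pairwise_map] at this
    have hsp : Spread ((posWord g).zip L') := by
      rw [← Spread.atomP_iff (n := n) h1 h2]
      · change AtomP (cnt n (((posWord g).zip L').map (Prod.fst ∘ Prod.snd)))
          (cnt n (((posWord g).zip L').map Prod.fst))
        rw [← List.map_map, m1, m2, cnt_posWord]
        exact hg.2
      · intro x hx
        exact lt_of_mem_posWord (List.of_mem_zip hx).1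
      · intro x hx
        exact hc.fst_lt (List.of_mem_zip hx).2
    have hs' := settle_eq_of_spread _ hsp (by rwa [m2])
    have hc' := isConf_of_spread hsp (by rwa [m2] : IsConf a b _)
    refine ⟨_, Finset.mem_filter.mpr ⟨mem_confSet.mpr hc', by rw [hs', m2]⟩, ?_⟩
    rw [List.map_map]
    change cnt n (((posWord g).zip L').map Prod.fst) = g
    rw [m1, cnt_posWord]

open Classical in
theorem slide_mul_atom_eq_sum_settled (a b : Fin n → ℕ) :
    fundamentalSlide a * fundamentalAtom b =
      ∑ L ∈ (confSet a b).filter Settled, fundamentalAtom (cnt n (L.map Prod.fst)) := by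
  rw [slide_mul_atom_eq, ← Finset.sum_fiberwise_of_maps_to (t := (confSet a b).filter Settled)
    (g := settle)]
  · refine Finset.sum_congr rfl fun L hL => ?_
    rw [Finset.mem_filter, mem_confSet] at hL
    rw [← fundamentalAtom_settled hL.1 hL.2]
  · intro L hL
    rw [mem_confSet] at hL
    rw [Finset.mem_filter, mem_confSet]
    exact ⟨hL.settle, (settle_spec n L hL.sorted).1⟩

end Conf

/-! ### Words with stars as settled words with positions -/

/-- The letters of a list of runs, each with the index of its run, counted from `k`. -/
def label : ℕ → List (List ℕ) → List (ℕ × ℕ)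
  | _, [] => []
  | k, r :: R => r.map (Prod.mk k) ++ label (k + 1) R

theorem label_fst {k : ℕ} {R : List (List ℕ)} {x : ℕ × ℕ} (h : x ∈ label k R) :
    k ≤ x.1 ∧ x.1 < k + R.length := by
  induction R generalizing k with
  | nil => simp [label] at h
  | cons r R ih =>
    rw [label, List.mem_append] at h
    rw [List.length_cons]
    rcases h with h | h
    · obtain ⟨c, -, rfl⟩ := List.mem_map.mp h
      simp only
      omega
    · have := ih h
      omega

theorem map_snd_label (k : ℕ) (R : List (List ℕ)) : (label k R).map Prod.snd = R.flatten := by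
  induction R generalizing k with
  | nil => rfl
  | cons r R ih =>
    rw [label, List.map_append, ih, List.flatten_cons, List.map_map]
    congr 1
    exact List.map_id r

theorem countP_label (k i : ℕ) (R : List (List ℕ)) (p : ℕ → Bool) :
    (label k R).countP (fun x => x.1 = k + i ∧ p x.2) = (R.getD i []).countP p := by
  induction R generalizing k i with
  | nil => simp [label]
  | cons r R ih =>
    rw [label, List.countP_append, List.countP_map]
    cases i with
    | zero =>
      have : (label (k + 1) R).countP (fun x => x.1 = k + 0 ∧ p x.2) = 0 := by
        rw [List.countP_eq_zero]
        intro x hx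
        have := label_fst hx
        simp only [decide_eq_true_eq]
        omega
      rw [this, List.getD_cons_zero, add_zero]
      refine List.countP_congr fun c _ => ?_
      simp
    | succ i =>
      have : r.countP ((fun x : ℕ × ℕ => decide (x.1 = k + (i + 1) ∧ p x.2 = true)) ∘ Prod.mk k)
          = 0 := by
        rw [List.countP_eq_zero]
        intro c _
        simp
      rw [this, zero_add, List.getD_cons_succ, ← ih (k + 1) i]
      refine List.countP_congr fun x _ => ?_
      rw [show k + 1 + i = k + (i + 1) by omega]

theorem des_eq (n : ℕ) (D : List (Option ℕ)) :
    des n D = cnt n ((label 0 (runs D)).map Prod.fst) := by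
  funext i
  have h := countP_label 0 i (runs D) fun _ => true
  rw [List.countP_true] at h
  rw [des, ← h, cnt, List.count, List.countP_map]
  refine List.countP_congr fun x _ => ?_
  simp

theorem count_part (r k i : ℕ) (R : List (List ℕ)) :
    ((part r (label k R)).map Prod.fst).count (k + i) =
      (R.getD i []).countP (fun c => c % 2 = r) := by
  rw [← countP_label k i, part, List.count, List.countP_map, List.countP_filter]
  refine List.countP_congr fun x _ => ?_
  simp

theorem desA_eq (n : ℕ) (D : List (Option ℕ)) :
    desA n D = cnt n ((part 1 (label 0 (runs D))).map Prod.fst) := by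
  funext i
  rw [desA, ← count_part 1 0, cnt, zero_add]

theorem desB_eq (n : ℕ) (D : List (Option ℕ)) :
    desB n D = cnt n ((part 0 (label 0 (runs D))).map Prod.fst) := by
  funext i
  rw [desB, ← count_part 0 0, cnt, zero_add]

theorem exists_runs_some (d : ℕ) (D : List (Option ℕ)) :
    ∃ r R, runs (some d :: D) = (d :: r) :: R := by
  induction D generalizing d with
  | nil => exact ⟨[], [], rfl⟩
  | cons x D ih =>
    cases x with
    | none => exact ⟨[], _, rfl⟩
    | some e =>
      obtain ⟨r, R, h⟩ := ih e
      rw [runs]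
      split_ifs
      · exact ⟨e :: r, R, by rw [h]; rfl⟩
      · exact ⟨[], _, rfl⟩

/-- The letters of a word starting with a number. -/
theorem label_runs_some (k c : ℕ) (D : List (Option ℕ)) :
    ∃ k', label k (runs (some c :: D)) = (k, c) :: label k' (runs D) ∧
      k + (runs (some c :: D)).length = max (k + 1) (k' + (runs D).length) ∧
      ((k' = k ∧ ∃ d D', D = some d :: D' ∧ c ≤ d) ∨
        (k' = k + 1 ∧ ∀ d D', D = some d :: D' → d < c)) := by
  rcases D with _ | ⟨_ | d, D⟩
  · exact ⟨k + 1, rfl, by simp [runs], Or.inr ⟨rfl, by simp⟩⟩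
  · exact ⟨k + 1, rfl, by simp only [runs, List.length_cons]; omega, Or.inr ⟨rfl, by simp⟩⟩
  · obtain ⟨r, R, h⟩ := exists_runs_some d D
    rw [runs]
    split_ifs with hcd
    · refine ⟨k, ?_, ?_, Or.inl ⟨rfl, d, D, rfl, hcd⟩⟩
      · rw [h]
        rfl
      · rw [h, List.modifyHead_cons, List.length_cons, List.length_cons]
        omega
    · refine ⟨k + 1, rfl, by rw [List.length_cons]; omega, Or.inr ⟨rfl, ?_⟩⟩
      intro d' D' e
      rw [List.cons.injEq, Option.some.injEq] at e
      omega

theorem flatten_runs (D : List (Option ℕ)) : (runs D).flatten = D.filterMap id := by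
  induction D with
  | nil => rfl
  | cons x D ih =>
    cases x with
    | none => simpa [runs] using ih
    | some c =>
      obtain ⟨k', h, -⟩ := label_runs_some 0 c D
      rw [← map_snd_label 0, h, List.map_cons, map_snd_label, ih]
      simp

theorem runs_replicate_append (m : ℕ) (D : List (Option ℕ)) :
    runs (List.replicate m none ++ D) = List.replicate m [] ++ runs D := by
  induction m with
  | zero => rfl
  | succ m ih => rw [List.replicate_succ, List.cons_append, runs, ih]; rfl

theorem label_replicate_append (k m : ℕ) (R : List (List ℕ)) :
    label k (List.replicate m [] ++ R) = label (k + m) R := by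
  induction m generalizing k with
  | zero => rfl
  | succ m ih =>
    rw [List.replicate_succ, List.cons_append, label, List.map_nil, List.nil_append, ih]
    congr 1
    omega

theorem StarsAtDescents.tail {x : Option ℕ} {D : List (Option ℕ)} (h : StarsAtDescents (x :: D)) :
    StarsAtDescents D :=
  fun u v c d m e => h (x :: u) v c d m (by rw [e]; rfl)

theorem exists_eq_of_head_filterMap {D : List (Option ℕ)} {d : ℕ}
    (h : (D.filterMap id).head? = some d) :
    ∃ m v, D = List.replicate m none ++ some d :: v := by
  induction D with
  | nil => simp at h
  | cons x D ih =>
    cases x with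
    | none =>
      obtain ⟨m, v, e⟩ := ih (by simpa using h)
      exact ⟨m + 1, v, by rw [e]; rfl⟩
    | some c =>
      refine ⟨0, D, ?_⟩
      simp at h
      simp [h]

/-- Without stars the run index is constant at ascents and grows at descents; stars always make it
grow. So the only obstruction to being settled is an ascent interrupted by stars. -/
theorem settled_label_iff (k : ℕ) (D : List (Option ℕ)) :
    Settled (label k (runs D)) ↔ StarsAtDescents D := by
  constructor
  · intro h u v c d m e
    induction u generalizing k D with
    | nil =>
      rw [List.nil_append, List.cons_append] at e
      obtain ⟨k', h1, -, h2⟩ := label_runs_some k c (List.replicate (m + 1) none ++ some d :: v)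
      obtain ⟨k'', h3, -⟩ := label_runs_some (k' + (m + 1)) d v
      rw [e, h1, runs_replicate_append, label_replicate_append, h3] at h
      have h4 := (List.isChain_cons_cons.mp h).1
      simp only at h4
      omega
    | cons x u ih =>
      subst e
      cases x with
      | none => exact ih (k + 1) _ h rfl
      | some x =>
        obtain ⟨k', h1, -⟩ := label_runs_some k x
          (u ++ some c :: List.replicate (m + 1) none ++ some d :: v)
        simp only [List.cons_append, List.append_assoc] at h h1 ⊢
        rw [h1] at h
        refine ih k' _ (List.IsChain.tail h) ?_
        simp
  · intro h
    induction D generalizing k with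
    | nil => exact List.IsChain.nil
    | cons x D ih =>
      cases x with
      | none => exact ih (k + 1) h.tail
      | some c =>
        obtain ⟨k', h1, -, h2⟩ := label_runs_some k c D
        rw [h1]
        refine List.IsChain.cons (ih k' h.tail) fun y hy => ?_
        have hy1 := label_fst (List.mem_of_mem_head? hy)
        have hy2 : (D.filterMap id).head? = some y.2 := by
          rw [← flatten_runs, ← map_snd_label k', List.head?_map, hy]
          rfl
        obtain ⟨m, v, e⟩ := exists_eq_of_head_filterMap hy2
        simp only
        rcases h2 with ⟨rfl, d, D', e1, e2⟩ | ⟨rfl, h2⟩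
        · obtain ⟨k'', h3, -⟩ := label_runs_some k' d D'
          rw [e1, h3, List.head?_cons, Option.mem_def, Option.some.injEq] at hy
          subst hy
          exact ⟨fun _ => rfl, fun hlt => absurd hlt (not_lt.mpr e2)⟩
        · have : y.2 < c := by
            cases m with
            | zero => exact h2 _ _ e
            | succ m => exact h [] v c y.2 m (by rw [e]; simp)
          omega

/-- The word with stars of a settled word with positions at least `k` and less than `n`. -/
def unlabel (n : ℕ) : ℕ → List (ℕ × ℕ) → List (Option ℕ)
  | k, [] => List.replicate (n - k) none
  | k, (p, c) :: L => List.replicate (p - k) none ++ some c :: unlabel n (p + 1) L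

theorem unlabel_cons_none {n k : ℕ} {L : List (ℕ × ℕ)} (hn : k < n) (h : ∀ x ∈ L, k < x.1) :
    unlabel n k L = none :: unlabel n (k + 1) L := by
  cases L with
  | nil =>
    rw [unlabel, unlabel, show n - k = (n - (k + 1)) + 1 by omega, List.replicate_succ]
  | cons x L =>
    obtain ⟨p, c⟩ := x
    have := h _ List.mem_cons_self
    simp only at this
    rw [unlabel, unlabel, show p - k = (p - (k + 1)) + 1 by omega, List.replicate_succ]
    rfl

theorem unlabel_label (k : ℕ) (D : List (Option ℕ)) {n : ℕ} (h : k + (runs D).length = n) :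
    unlabel n k (label k (runs D)) = D := by
  induction D generalizing k with
  | nil =>
    simp only [runs, List.length_nil] at h
    simp [runs, label, unlabel, ← h]
  | cons x D ih =>
    cases x with
    | none =>
      rw [runs, List.length_cons] at h
      change unlabel n k (label (k + 1) (runs D)) = _
      rw [unlabel_cons_none (by omega) fun x hx => (label_fst hx).1, ih (k + 1) (by omega)]
    | some c =>
      obtain ⟨k', h1, h2, h3⟩ := label_runs_some k c D
      rw [h1, unlabel, Nat.sub_self, List.replicate_zero, List.nil_append]
      congr 1
      rcases h3 with ⟨rfl, d, D', rfl, -⟩ | ⟨rfl, -⟩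
      -- The next letter continues the run. Both `k' - k'` and the truncated `k' - (k' + 1)` vanish,
      -- so no star is written.
      · obtain ⟨k'', h4, -⟩ := label_runs_some k' d D'
        obtain ⟨r, R, h5⟩ := exists_runs_some d D'
        have h6 := ih k' (by rw [h5, List.length_cons] at h2 ⊢; omega)
        rw [h4, unlabel] at h6 ⊢
        rw [← h6]
        simp
      · exact ih (k + 1) (by omega)

theorem label_unlabel_cons {n : ℕ} (p c : ℕ) (L : List (ℕ × ℕ)) (hs : Settled ((p, c) :: L))
    (hn : ∀ x ∈ (p, c) :: L, x.1 < n) :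
    label p (runs (some c :: unlabel n (p + 1) L)) = (p, c) :: L ∧
      p + (runs (some c :: unlabel n (p + 1) L)).length = n := by
  induction L generalizing p c with
  | nil =>
    have hp := hn _ List.mem_cons_self
    obtain ⟨k', h1, h2, h3⟩ := label_runs_some p c (unlabel n (p + 1) [])
    have e : runs (unlabel n (p + 1) []) = List.replicate (n - (p + 1)) [] := by
      have := runs_replicate_append (n - (p + 1)) []
      simpa [unlabel, runs] using this
    have e' : label k' (List.replicate (n - (p + 1)) []) = [] := by
      have := label_replicate_append k' (n - (p + 1)) []
      simpa [label] using this
    rw [h1, h2, e, e', List.length_replicate]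
    refine ⟨rfl, ?_⟩
    simp only at hp
    rcases h3 with ⟨-, d, D', h4, -⟩ | ⟨rfl, -⟩
    · have : some d ∈ unlabel n (p + 1) [] := by rw [h4]; exact List.mem_cons_self
      simp [unlabel] at this
    · omega
  | cons y L ih =>
    obtain ⟨q, d⟩ := y
    obtain ⟨hc, hs⟩ := List.isChain_cons_cons.mp hs
    simp only at hc
    obtain ⟨ih1, ih2⟩ := ih q d hs fun x hx => hn x (List.mem_cons_of_mem _ hx)
    obtain ⟨k', h1, h2, h3⟩ := label_runs_some p c (unlabel n (p + 1) ((q, d) :: L))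
    have hp := hn _ List.mem_cons_self
    simp only at hp
    rw [h1, h2, unlabel, runs_replicate_append, label_replicate_append, List.length_append,
      List.length_replicate]
    -- At an ascent `k' = p = q` and the difference truncates to `0`; at a descent `k' = p + 1` and
    -- the stars supply the skipped runs.
    have hk : k' + (q - (p + 1)) = q := by
      rcases h3 with ⟨rfl, d', D', e, hcd⟩ | ⟨rfl, h3⟩
      · rw [unlabel] at e
        cases hm : q - (k' + 1) with
        | zero =>
          rw [hm] at e
          simp only [List.replicate_zero, List.nil_append, List.cons.injEq, Option.some.injEq] at e
          omega
        | succ m =>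
          rw [hm, List.replicate_succ] at e
          simp at e
      · have h4 : q ≠ p := by
          rintro rfl
          have := h3 d (unlabel n (q + 1) L) (by simp [unlabel])
          omega
        omega
    rw [hk, ih1]
    exact ⟨rfl, by omega⟩

theorem label_unlabel {n : ℕ} {L : List (ℕ × ℕ)} (hs : Settled L) (hn : ∀ x ∈ L, x.1 < n) :
    label 0 (runs (unlabel n 0 L)) = L ∧ (runs (unlabel n 0 L)).length = n := by
  cases L with
  | nil =>
    have e : runs (unlabel n 0 []) = List.replicate n [] := by
      have := runs_replicate_append n []
      simpa [unlabel, runs] using this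
    have := label_replicate_append 0 n []
    rw [e]
    exact ⟨by simpa [label] using this, List.length_replicate⟩
  | cons x L =>
    obtain ⟨p, c⟩ := x
    obtain ⟨h1, h2⟩ := label_unlabel_cons p c L hs hn
    rw [unlabel, runs_replicate_append, label_replicate_append, Nat.sub_zero, zero_add,
      List.length_append, List.length_replicate]
    exact ⟨h1, h2⟩

/-! ### Shuffles -/

theorem shuffle_filter {T : Type} (p : T → Bool) (w : List T) :
    Shuffle (w.filter p) (w.filter fun x => !p x) w := by
  induction w with
  | nil => exact Shuffle.nil
  | cons x w ih =>
    cases h : p x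
    · simpa [h] using Shuffle.right x ih
    · simpa [h] using Shuffle.left x ih

/-- With `shuffle_filter` this turns shuffles of words over disjoint alphabets into conditions on
subwords. -/
theorem Shuffle.filter_eq {T : Type} {p : T → Bool} {u v w : List T} (h : Shuffle u v w)
    (hu : ∀ x ∈ u, p x) (hv : ∀ x ∈ v, ¬ p x) :
    w.filter p = u ∧ (w.filter fun x => !p x) = v := by
  induction h with
  | nil => exact ⟨rfl, rfl⟩
  | left x _ ih =>
    obtain ⟨h1, h2⟩ := ih (fun y hy => hu y (List.mem_cons_of_mem _ hy)) hv
    have := hu x List.mem_cons_self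
    simp [this, h1, h2]
  | right x _ ih =>
    obtain ⟨h1, h2⟩ := ih hu (fun y hy => hv y (List.mem_cons_of_mem _ hy))
    have := hv x List.mem_cons_self
    simp [this, h1, h2]

theorem shuffle_replicate_none_iff (C : List ℕ) (D : List (Option ℕ)) :
    (∃ k, Shuffle (C.map some) (List.replicate k none) D) ↔ D.filterMap id = C := by
  have hD : D.filter Option.isSome = (D.filterMap id).map some := by
    induction D with
    | nil => rfl
    | cons x D ih => cases x <;> simp [ih]
  constructor
  · rintro ⟨k, h⟩
    have h1 := (h.filter_eq (p := Option.isSome) (by simp) (by simp)).1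
    rw [hD] at h1
    exact List.map_injective_iff.mpr (Option.some_injective _) h1
  · rintro rfl
    refine ⟨(D.filter fun x => !x.isSome).length, ?_⟩
    have h := shuffle_filter Option.isSome D
    rw [hD] at h
    convert h using 1
    rw [eq_comm, List.eq_replicate_iff]
    refine ⟨rfl, fun x hx => ?_⟩
    have := (List.mem_filter.mp hx).2
    simpa using this

theorem exists_shuffle_iff {n : ℕ} (a b : Fin n → ℕ) (D : List (Option ℕ)) :
    (∃ (k : ℕ) (C : List ℕ), Shuffle (wordA a) (wordB b) C ∧
      Shuffle (C.map some) (List.replicate k none) D) ↔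
      (part 1 (label 0 (runs D))).map Prod.snd = letterWord 1 a ∧
        (part 0 (label 0 (runs D))).map Prod.snd = letterWord 0 b := by
  rw [exists_comm]
  simp only [exists_and_left, shuffle_replicate_none_iff, map_snd_part, map_snd_label,
    flatten_runs, exists_eq_right', wordA_eq, wordB_eq]
  have e : (D.filterMap id).filter (fun v => !decide (v % 2 = 1)) =
      (D.filterMap id).filter fun v => v % 2 = 0 := by
    refine List.filter_congr fun v _ => ?_
    rcases Nat.mod_two_eq_zero_or_one v with hp | hp <;> simp [hp]
  constructor
  · intro h
    have h' := h.filter_eq (p := fun v => v % 2 = 1)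
      (fun x hx => by simpa using (mem_letterWord le_rfl hx).2.1)
      (fun x hx => by simpa using (mem_letterWord zero_le_one hx).2.1)
    rwa [e] at h'
  · rintro ⟨h1, h2⟩
    have h := shuffle_filter (fun v => decide (v % 2 = 1)) (D.filterMap id)
    rwa [e, h1, h2] at h

/-- With run indices as positions, the shuffle condition gives the two subwords, the star condition
gives `Settled`, and the remaining conditions are `slideP_iff` and `atomP_iff`. -/
theorem inQSSet_iff {n : ℕ} (a b : Fin n → ℕ) (D : List (Option ℕ)) :
    InQSSet a b D ↔ (runs D).length = n ∧ Settled (label 0 (runs D)) ∧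
      IsConf a b (label 0 (runs D)) := by
  constructor
  · intro h
    have hs := (settled_label_iff 0 D).mpr h.stars
    obtain ⟨h1, h2⟩ := (exists_shuffle_iff a b D).mp h.shuffle
    refine ⟨h.runs_length, hs, (isConf_iff hs.pairwise h1 h2 fun x hx => ?_).mpr ?_⟩
    · have := label_fst hx
      have := h.runs_length
      omega
    · rw [← desA_eq, ← desB_eq, slideP_iff, atomP_iff]
      exact ⟨⟨h.domA, h.refines⟩, h.domB, h.domB_shift⟩
  · rintro ⟨h1, h2, h3⟩
    have h4 := (isConf_iff h3.sorted h3.odd h3.even fun x => h3.fst_lt).mp h3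
    rw [← desA_eq, ← desB_eq, slideP_iff, atomP_iff] at h4
    exact ⟨(exists_shuffle_iff a b D).mpr ⟨h3.odd, h3.even⟩, h1, (settled_label_iff 0 D).mp h2,
      h4.1.2, h4.1.1, h4.2.1, h4.2.2⟩

end FundAtom

end

/-! ### The product formula -/

theorem mainTheorem2 {n : ℕ} (α β : Fin n → ℕ) :
    FundAtom.fundamentalSlide α * FundAtom.fundamentalAtom β =
      ∑ D ∈ FundAtom.qSSet α β, FundAtom.fundamentalAtom (FundAtom.des n D) := by
  classical
  rw [FundAtom.slide_mul_atom_eq_sum_settled]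
  refine Finset.sum_bij' (fun L _ => FundAtom.unlabel n 0 L)
    (fun D _ => FundAtom.label 0 (FundAtom.runs D)) ?_ ?_ ?_ ?_ ?_
  · intro L hL
    rw [Finset.mem_filter, FundAtom.mem_confSet] at hL
    obtain ⟨h1, h2⟩ := FundAtom.label_unlabel hL.2 fun x => hL.1.fst_lt
    rw [FundAtom.mem_qSSet, FundAtom.inQSSet_iff, h1]
    exact ⟨h2, hL.2, hL.1⟩
  · intro D hD
    rw [FundAtom.mem_qSSet, FundAtom.inQSSet_iff] at hD
    rw [Finset.mem_filter, FundAtom.mem_confSet]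
    exact ⟨hD.2.2, hD.2.1⟩
  · intro L hL
    rw [Finset.mem_filter, FundAtom.mem_confSet] at hL
    exact (FundAtom.label_unlabel hL.2 fun x => hL.1.fst_lt).1
  · intro D hD
    rw [FundAtom.mem_qSSet, FundAtom.inQSSet_iff] at hD
    exact FundAtom.unlabel_label 0 D (by rw [zero_add, hD.1])
  · intro L hL
    rw [Finset.mem_filter, FundAtom.mem_confSet] at hL
    rw [FundAtom.des_eq, (FundAtom.label_unlabel hL.2 fun x => hL.1.fst_lt).1]
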